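/- **Lemma (Stable function approximation via Lanczos).** Let $A\in\mathbb R^{n\times n}$ be symmetric with smallest and largest eigenvalues $\lambda_{\min},\lambda_{\max}$, let $0\ne x\in\mathbb R^n$ and let $k\ge 1$. Vectors carry the Euclidean norm and matrices the spectral norm, and for symmetric $M=V\Lambda V^T$ we put $f(M)=Vf(\Lambda)V^T$. *Finite precision Lanczos.* Put $q_0=0$, $\beta_1=0$ and $q_1=x/\|x\|$. For $i=1,\dots,k$ compute $$u=Aq_i-\beta_iq_{i-1},\qquad \alpha_i=\langle u,q_i\rangle,\qquad w=u-\alpha_iq_i,\qquad \beta_{i+1}=\|w\|,$$ leave the loop if $\beta_{i+1}=0$, and otherwise compute $q_{i+1}=w/\beta_{i+1}$. Let $m\le k$ be the number of passes through the loop (so $m=k$ unless some $\beta_{i+1}=0$ with $i<k$, in which case $m$ is the first such $i$), let $Q=[q_1,\dots,q_m]$, and let $T\in\mathbb R^{m\times m}$ be the symmetric tridiagonal matrix with diagonal $\alpha_1,\dots,\alpha_m$ and off-diagonal $\beta_2,\dots,\beta_m$. All of this (including the computation of $q_1$) is done on a computer with relative precision $\epsilon_{mach}$, that is: 1. each operation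 $+,-,\times,\div$ and each square root returns $(1+\delta)$ times the exact result, for some $|\delta|\le\epsilon_{mach}$ that may differ from operation to operation (inner products are sums, in any order, of products, and $\|w\|=\sqrt{\langle w,w\rangle}$; there is no overflow or underflow); 2. each product $Aw$ is computed with an error of norm at most $2n^{3/2}\|A\|\,\|w\|\,\epsilon_{mach}$. Below, $q_1,Q,T$ are the computed quantities. *Claim.* Let $\eta>0$ satisfy $85\,n^{3/2}k^{5/2}\|A\|\,\epsilon_{mach}\le\eta\le\|A\|$. Let $f:\mathbb R\to\mathbb R$ be bounded on $I=[\lambda_{\min}-\eta,\lambda_{\max}+\eta]$, and set $$\delta_k=\inf_{\substack{p\text{ a real polynomial}\\ \text{of degree}<k}}\ \sup_{t\in I}|f(t)-p(t)|,\qquad C=\sup_{t\in I}|f(t)|.$$ Then, with $e_1$ the first standard basis vector of $\mathbb R^m$, $$\|f(A)q_1-Qf(T)e_1\|\le (k+2)\,\delta_k+\epsilon_{mach}\cdot\frac{41\,C\,k^4n^{3/2}\|A\|}{\eta}.$$ -/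

import Mathlib

open scoped Matrix.Norms.L2Operator

namespace FPLanczos

/-- `RoundsTo ε z c`: the computed value `c` is `(1 + δ) * z` for some `|δ| ≤ ε`, where `z` is the
exact result of the operation. This is the accuracy requirement on one elementary operation
(`+`, `-`, `*`, `/`, square root) of a computer with relative precision `ε`. -/
def RoundsTo (ε z c : ℝ) : Prop :=
  ∃ δ : ℝ, |δ| ≤ ε ∧ c = (1 + δ) * z

/-- `SumsTo ε s c`: adding up the (nonempty) multiset `s` by rounded additions, in some order and
with some bracketing, can return `c`. -/
inductive SumsTo (ε : ℝ) : Multiset ℝ → ℝ → Prop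
  | single (a : ℝ) : SumsTo ε {a} a
  | add {s t : Multiset ℝ} {a b c : ℝ} (hs : SumsTo ε s a) (ht : SumsTo ε t b)
      (hc : RoundsTo ε (a + b) c) : SumsTo ε (s + t) c

/-- `InnerTo ε u v c`: computing the inner product `⟨u, v⟩` from rounded products and rounded
additions can return `c`. -/
def InnerTo {n : ℕ} (ε : ℝ) (u v : EuclideanSpace ℝ (Fin n)) (c : ℝ) : Prop :=
  ∃ p : Fin n → ℝ, (∀ j, RoundsTo ε (u j * v j) (p j)) ∧
    SumsTo ε ((Finset.univ : Finset (Fin n)).val.map p) c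

/-- `NormTo ε w c`: computing the Euclidean norm of `w` as the rounded square root of the computed
`⟨w, w⟩` can return `c`. -/
def NormTo {n : ℕ} (ε : ℝ) (w : EuclideanSpace ℝ (Fin n)) (c : ℝ) : Prop :=
  ∃ s : ℝ, InnerTo ε w w s ∧ RoundsTo ε (Real.sqrt s) c

/-- `MatVecTo ε A w p`: `p` is an admissible result of computing `A w`: the error is at most
`2 n^{3/2} ‖A‖ ‖w‖ ε`, with `‖A‖` the spectral norm. -/
def MatVecTo {n : ℕ} (ε : ℝ) (A : Matrix (Fin n) (Fin n) ℝ)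
    (w p : EuclideanSpace ℝ (Fin n)) : Prop :=
  ‖p - WithLp.toLp 2 (A.mulVec w.ofLp)‖ ≤ 2 * (n : ℝ) ^ (3 / 2 : ℝ) * ‖A‖ * ‖w‖ * ε

/-- One pass through the loop of the Lanczos algorithm in finite precision: from
`qprev = q_{i-1}`, `qcur = q_i` and `b = β_i` it can produce `a = α_i`, `b' = β_{i+1}` and, unless
`β_{i+1} = 0`, the vector `qnext = q_{i+1}`. -/
def LanczosStep {n : ℕ} (ε : ℝ) (A : Matrix (Fin n) (Fin n) ℝ)
    (qprev qcur : EuclideanSpace ℝ (Fin n)) (b a b' : ℝ)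
    (qnext : EuclideanSpace ℝ (Fin n)) : Prop :=
  ∃ p s u t w : EuclideanSpace ℝ (Fin n),
    -- `u = A q_i - β_i q_{i-1}`
    MatVecTo ε A qcur p ∧
    (∀ j, RoundsTo ε (b * qprev j) (s j)) ∧
    (∀ j, RoundsTo ε (p j - s j) (u j)) ∧
    -- `α_i = ⟨u, q_i⟩`
    InnerTo ε u qcur a ∧
    -- `w = u - α_i q_i`
    (∀ j, RoundsTo ε (a * qcur j) (t j)) ∧
    (∀ j, RoundsTo ε (u j - t j) (w j)) ∧
    -- `β_{i+1} = ‖w‖` and `q_{i+1} = w / β_{i+1}`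
    NormTo ε w b' ∧
    (b' ≠ 0 → ∀ j, RoundsTo ε (w j / b') (qnext j))

/-- A run of the Lanczos algorithm on the matrix `A`, the starting vector `x` and the iteration
count `k`, on a computer with relative precision `ε`. Here `m` is the number of passes through the
loop: the loop is left after `k` passes, or earlier, after the first pass `i` with `β_{i+1} = 0`. -/
structure LanczosRun {n : ℕ} (ε : ℝ) (A : Matrix (Fin n) (Fin n) ℝ)
    (x : EuclideanSpace ℝ (Fin n)) (k m : ℕ)
    (q : ℕ → EuclideanSpace ℝ (Fin n)) (α β : ℕ → ℝ) : Prop where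
  q_zero : q 0 = 0
  q_one : ∃ ν : ℝ, NormTo ε x ν ∧ ∀ j, RoundsTo ε (x j / ν) (q 1 j)
  beta_one : β 1 = 0
  one_le : 1 ≤ m
  le_k : m ≤ k
  step : ∀ i, 1 ≤ i → i ≤ m →
    LanczosStep ε A (q (i - 1)) (q i) (β i) (α i) (β (i + 1)) (q (i + 1))
  not_stopped : ∀ i, 1 ≤ i → i < m → β (i + 1) ≠ 0
  stopped : m = k ∨ β (m + 1) = 0

/-- The matrix `Q = [q_1, …, q_m]`. -/
def lanczosQ {n : ℕ} (m : ℕ) (q : ℕ → EuclideanSpace ℝ (Fin n)) : Matrix (Fin n) (Fin m) ℝ :=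
  Matrix.of fun i j => q (j + 1) i

/-- The symmetric tridiagonal matrix `T` with diagonal `α_1, …, α_m` and off-diagonal
`β_2, …, β_m`. -/
def lanczosT (m : ℕ) (α β : ℕ → ℝ) : Matrix (Fin m) (Fin m) ℝ :=
  Matrix.of fun i j =>
    if (i : ℕ) = j then α (i + 1)
    else if (i : ℕ) + 1 = j then β (j + 1)
    else if (j : ℕ) + 1 = i then β (i + 1)
    else 0

theorem lanczosT_isHermitian (m : ℕ) (α β : ℕ → ℝ) : (lanczosT m α β).IsHermitian := by
  ext i j
  simp only [lanczosT, Matrix.conjTranspose_apply, Matrix.of_apply, star_trivial]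
  split_ifs with h1 h2 h3 h4 h5 h6 <;> first | rfl | omega | (rw [h1])

/-- The first standard basis vector of length `m`. -/
def e1 (m : ℕ) : Fin m → ℝ := fun j => if (j : ℕ) = 0 then 1 else 0

/-- The smallest eigenvalue of a real symmetric matrix (of positive size). -/
noncomputable def lamMin {n : ℕ} {A : Matrix (Fin n) (Fin n) ℝ} (hA : A.IsHermitian) : ℝ :=
  ⨅ i, hA.eigenvalues i

/-- The largest eigenvalue of a real symmetric matrix (of positive size). -/
noncomputable def lamMax {n : ℕ} {A : Matrix (Fin n) (Fin n) ℝ} (hA : A.IsHermitian) : ℝ :=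
  ⨆ i, hA.eigenvalues i

/-- The supremum of `|g|` on the interval `[a, b]`. -/
noncomputable def supAbs (g : ℝ → ℝ) (a b : ℝ) : ℝ :=
  ⨆ x : Set.Icc a b, |g x|

/-- The best uniform error on `[a, b]` in approximating `f` by a polynomial of degree `< k`. -/
noncomputable def bestError (f : ℝ → ℝ) (a b : ℝ) (k : ℕ) : ℝ :=
  ⨅ p : Polynomial.degreeLT ℝ k,
    supAbs (fun x => f x - (p : Polynomial ℝ).eval x) a b

end FPLanczos

open FPLanczos

/-!
Replacing `f` by a polynomial `p` of degree `< k` costs `sup |f - p|` times `‖q₁‖ + ‖Q‖`, which is at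
most `k + 2`, provided that the spectra of both `A` and `T` lie in the interval `I` where `p`
approximates `f`. It remains to see that `p(A) q₁` and `Q p(T) e₁` almost agree, and that `T` has its
spectrum in `I`. Rounding errors are measured by `e = n^{3/2} ε` and `‖A‖`.

*Rounding.* One pass of the loop satisfies `A q_i = β_{i+1} q_{i+1} + α_i q_i + β_i q_{i-1} + f_i` with
`‖f_i‖ ≤ 8.2 e ‖A‖`, and `q_i`, `q_{i+1}` are nearly orthonormal in the sense that
`β_{i+1} ⟪q_i, q_{i+1}⟫` is small (`stepBounds_of_perturbed`). This requires `α_i` and `β_i` to be of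
the size of `‖A‖`, which is not clear a priori: `‖A q_i - β_i q_{i-1}‖ ≤ ‖A‖ + |β_i|` alone would let
them grow. The products `β_i β_{i+1} ⟪q_{i-1}, q_{i+1}⟫` turn out to grow only linearly in `i`, and this
prevents the growth of the coefficients (`stepBounds_of_run`). No global orthogonality holds.

*Spectrum of `T`.* Let `R` be the strictly upper triangular part of the Gram matrix of the `q_i`. The
symmetry of `A` makes the commutator `T R - R T` small, except for its last column, which is
`β_{s+1} ⟪q_i, q_{s+1}⟫` (`ApproxLanczos.abs_commDefect_le`). The trace of `X (T R - R T)` vanishes for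
every `X` that commutes with `T`, so the trace of `X` against the last column is small
(`sum_mul_inner_eq_neg_sum_commDefect`). This is applied twice. Let `T y = μ y` and `z = Q y`. For the
resolvents `X = (μ - T_s)⁻¹` of the leading submatrices, whose last columns are multiples of the
leading parts of `y`, it shows that `‖z‖² ≥ ‖y‖² / 2` if `μ` exceeds the spectra of all `T_s` by a
sufficient gap. For `X = y yᵀ` it shows that the Rayleigh quotient of `z` is close to `μ`, whence
`μ ≤ λ_max + O(e k ‖A‖)`. If there is no gap, `μ` is close to the bound for a smaller matrix, and the
gaps, each `O(e k^{3/2} ‖A‖)`, add up to `O(e k^{5/2} ‖A‖)` (`ApproxLanczos.quadForm_le`). The lower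
bound follows by passing to `-A`.

*Polynomials.* After rescaling `I` to `[-1, 1]`, `p` is a combination of the Chebyshev polynomials
`T_j` with coefficients at most `2 sup |p|`. The differences `T_j(A) q₁ - Q T_j(T) e₁` satisfy the
Chebyshev recurrence with inhomogeneities `(A Q - Q T) T_j(T) e₁`, and are therefore sums of Chebyshev
polynomials of the second kind in `A` applied to these; the latter polynomials are bounded by their
degree plus one (`norm_aeval_T_sub_le`). The last column of `A Q - Q T` contains the large vector
`β_{m+1} q_{m+1}`, but the last coordinate of `T_j(T) e₁` vanishes for all `j` that matter.
-/

namespace FPLanczos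

open scoped RealInnerProductSpace

/-! ### Rounded elementary operations -/

theorem RoundsTo.abs_sub_le {ε z c : ℝ} (h : RoundsTo ε z c) : |c - z| ≤ ε * |z| := by
  obtain ⟨δ, hδ, rfl⟩ := h
  have : (1 + δ) * z - z = δ * z := by ring
  rw [this, abs_mul]
  gcongr

theorem RoundsTo.nonneg {ε z c : ℝ} (h : RoundsTo ε z c) : 0 ≤ ε := by
  obtain ⟨δ, hδ, -⟩ := h
  exact (abs_nonneg δ).trans hδ

/-- Coordinatewise rounding perturbs a vector by a relative error `ε` in the Euclidean norm. -/
theorem norm_sub_le_of_roundsTo {n : ℕ} {ε : ℝ} (hε : 0 ≤ ε) {z c : EuclideanSpace ℝ (Fin n)}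
    (h : ∀ j, RoundsTo ε (z j) (c j)) : ‖c - z‖ ≤ ε * ‖z‖ := by
  have h1 : ε * ‖z‖ = ‖ε • z‖ := by rw [norm_smul, Real.norm_of_nonneg hε]
  rw [h1, EuclideanSpace.norm_eq, EuclideanSpace.norm_eq]
  refine Real.sqrt_le_sqrt (Finset.sum_le_sum fun j _ => ?_)
  have := (h j).abs_sub_le
  simp only [PiLp.sub_apply, PiLp.smul_apply, smul_eq_mul, Real.norm_eq_abs, abs_mul,
    abs_of_nonneg hε]
  gcongr

theorem SumsTo.card_pos {ε : ℝ} {s : Multiset ℝ} {c : ℝ} (h : SumsTo ε s c) : 1 ≤ s.card := by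
  induction h with
  | single a => simp
  | add hs ht hc ihs iht => rw [Multiset.card_add]; omega

/-- Every summand passes through at most `card s - 1` rounded additions, whatever the order of the
summation. -/
theorem SumsTo.abs_sub_sum_le {ε : ℝ} (hε : 0 ≤ ε) {s : Multiset ℝ} {c : ℝ} (h : SumsTo ε s c) :
    |c - s.sum| ≤ ((1 + ε) ^ (s.card - 1) - 1) * (s.map abs).sum := by
  induction h with
  | single a => simp
  | @add s t a b c hs ht hc ihs iht =>
    have hs1 := hs.card_pos
    have ht1 := ht.card_pos
    have hc' := hc.abs_sub_le
    rw [Multiset.sum_add, Multiset.map_add, Multiset.sum_add, Multiset.card_add]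
    set S := (s.map abs).sum with hS
    set T := (t.map abs).sum with hT
    have hSs : |s.sum| ≤ S := Multiset.abs_sum_le_sum_abs
    have hTt : |t.sum| ≤ T := Multiset.abs_sum_le_sum_abs
    have hS0 : 0 ≤ S := (abs_nonneg _).trans hSs
    have hT0 : 0 ≤ T := (abs_nonneg _).trans hTt
    set P := (1 + ε) ^ (s.card + t.card - 1)
    have hP : ∀ l : ℕ, l + 1 ≤ s.card + t.card - 1 → (1 + ε) * (1 + ε) ^ l ≤ P := by
      intro l hl
      rw [← pow_succ']
      exact pow_le_pow_right₀ (by linarith) hl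
    have hPs := hP (s.card - 1) (by omega)
    have hPt := hP (t.card - 1) (by omega)
    set p := (1 + ε) ^ (s.card - 1)
    set r := (1 + ε) ^ (t.card - 1)
    have h1 : |c - (s.sum + t.sum)| ≤ |c - (a + b)| + (|a - s.sum| + |b - t.sum|) := by
      calc |c - (s.sum + t.sum)| = |(c - (a + b)) + ((a - s.sum) + (b - t.sum))| := by ring_nf
        _ ≤ _ := (abs_add_le _ _).trans (by gcongr; exact abs_add_le _ _)
    have h2 : |a + b| ≤ (|a - s.sum| + |b - t.sum|) + (S + T) := by
      calc |a + b| = |((a - s.sum) + (b - t.sum)) + (s.sum + t.sum)| := by ring_nf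
        _ ≤ _ := (abs_add_le _ _).trans (add_le_add (abs_add_le _ _)
          ((abs_add_le _ _).trans (add_le_add hSs hTt)))
    have h3 : |c - (s.sum + t.sum)| ≤ (1 + ε) * ((p - 1) * S + (r - 1) * T) + ε * (S + T) := by
      have : ε * |a + b| ≤ ε * (((p - 1) * S + (r - 1) * T) + (S + T)) := by
        gcongr
        linarith
      linarith
    have h4 : (1 + ε) * p * S ≤ P * S := by gcongr
    have h5 : (1 + ε) * r * T ≤ P * T := by gcongr
    linarith

theorem InnerTo.abs_sub_inner_le {n : ℕ} {ε : ℝ} (hε : 0 ≤ ε) {u v : EuclideanSpace ℝ (Fin n)}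
    {c : ℝ} (h : InnerTo ε u v c) :
    |c - ⟪u, v⟫| ≤ ((1 + ε) ^ n - 1) * (‖u‖ * ‖v‖) := by
  obtain ⟨p, hp, hc⟩ := h
  have hcard := hc.card_pos
  have h1 := hc.abs_sub_sum_le hε
  simp only [Multiset.card_map, Finset.card_val, Finset.card_univ, Fintype.card_fin,
    Multiset.map_map] at h1 hcard
  change |c - ∑ j, p j| ≤ _ * ∑ j, |p j| at h1
  set a : ℝ := ∑ j, |u j * v j|
  have hin : ⟪u, v⟫ = ∑ j, u j * v j := by
    simp [PiLp.inner_apply, mul_comm]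
  have h2 : |(∑ j, p j) - ⟪u, v⟫| ≤ ε * a := by
    rw [hin, ← Finset.sum_sub_distrib, Finset.mul_sum]
    exact (Finset.abs_sum_le_sum_abs _ _).trans
      (Finset.sum_le_sum fun j _ => (hp j).abs_sub_le)
  have h3 : ∑ j, |p j| ≤ (1 + ε) * a := by
    rw [Finset.mul_sum]
    refine Finset.sum_le_sum fun j _ => ?_
    have := (hp j).abs_sub_le
    have := abs_add_le (p j - u j * v j) (u j * v j)
    rw [sub_add_cancel] at this
    linarith
  have ha : a ≤ ‖u‖ * ‖v‖ := by
    have h5 := Real.sum_mul_le_sqrt_mul_sqrt Finset.univ (fun j => |u j|) (fun j => |v j|)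
    simp only [EuclideanSpace.norm_eq, Real.norm_eq_abs]
    simpa [a, abs_mul] using h5
  have hpow : (1 + ε) ^ n = (1 + ε) ^ (n - 1) * (1 + ε) := by
    rw [← pow_succ]; congr 1; omega
  have h6 : 1 ≤ (1 + ε) ^ (n - 1) := one_le_pow₀ (by linarith)
  have h7 : ((1 + ε) ^ (n - 1) - 1) * ∑ j, |p j| ≤ ((1 + ε) ^ (n - 1) - 1) * ((1 + ε) * a) :=
    mul_le_mul_of_nonneg_left h3 (by linarith)
  have h8 : |c - ⟪u, v⟫| ≤ ((1 + ε) ^ n - 1) * a := by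
    have := abs_add_le (c - ∑ j, p j) ((∑ j, p j) - ⟪u, v⟫)
    rw [sub_add_sub_cancel] at this
    rw [hpow]
    linarith
  exact h8.trans (mul_le_mul_of_nonneg_left ha (by rw [hpow]; nlinarith))

/-- The relative precision `ε` is so small for dimension `n` that all accumulated relative errors
are governed by a single number `e`, in the application `n^{3/2} ε`. -/
structure SmallPrecision (n : ℕ) (ε e : ℝ) : Prop where
  nonneg : 0 ≤ ε
  le : ε ≤ e
  small : e ≤ 1 / 85
  pow_le : (1 + ε) ^ n - 1 ≤ 1.02 * e

theorem one_add_pow_sub_one_le {n : ℕ} {ε : ℝ} (hε : 0 ≤ ε) (h : n * ε ≤ 1 / 85) :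
    (1 + ε) ^ n - 1 ≤ 1.02 * (n * ε) := by
  have h1 : (1 + ε) ^ n ≤ Real.exp (n * ε) := by
    rw [Real.exp_nat_mul]
    exact pow_le_pow_left₀ (by linarith) (by linarith [Real.add_one_le_exp ε]) n
  have h0 : 0 ≤ n * ε := by positivity
  have h2 := Real.abs_exp_sub_one_sub_id_le (x := n * ε) (by rw [abs_of_nonneg h0]; linarith)
  have h3 := (abs_le.1 h2).2
  nlinarith

theorem NormTo.abs_sub_norm_le {n : ℕ} {ε e : ℝ} (h : SmallPrecision n ε e)
    {w : EuclideanSpace ℝ (Fin n)} {c : ℝ} (hc : NormTo ε w c) :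
    |c - ‖w‖| ≤ 1.53 * e * ‖w‖ := by
  obtain ⟨s, hs, hc⟩ := hc
  have h0 := h.nonneg
  have hle := h.le
  have hsm := h.small
  have he0 : 0 ≤ e := h0.trans hle
  have h1 := hs.abs_sub_inner_le h.nonneg
  rw [real_inner_self_eq_norm_sq] at h1
  have h2 := hc.abs_sub_le
  rw [abs_of_nonneg (Real.sqrt_nonneg s)] at h2
  have hw := norm_nonneg w
  have h3 : |s - ‖w‖ ^ 2| ≤ 1.02 * e * ‖w‖ ^ 2 := by
    refine h1.trans ?_
    rw [← sq]
    exact mul_le_mul_of_nonneg_right h.pow_le (sq_nonneg _)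
  rw [abs_le] at h3 h2
  have hs0 : 0 ≤ s := by nlinarith [sq_nonneg ‖w‖]
  have hsq := Real.sq_sqrt hs0
  have hr := Real.sqrt_nonneg s
  set r := Real.sqrt s
  have hup : r ≤ (1 + 0.51 * e) * ‖w‖ := by
    refine abs_le_of_sq_le_sq' ?_ (by positivity) |>.2
    nlinarith [sq_nonneg (e * ‖w‖)]
  have hlo : (1 - 0.52 * e) * ‖w‖ ≤ r := by
    refine abs_le_of_sq_le_sq' ?_ hr |>.2
    have : 0 ≤ (0.02 * e - 0.2704 * e ^ 2) * ‖w‖ ^ 2 := by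
      apply mul_nonneg _ (sq_nonneg _)
      nlinarith
    nlinarith
  have hεr : ε * r ≤ e * ((1 + 0.51 * e) * ‖w‖) := by gcongr
  have hew : e * (e * ‖w‖) ≤ 1 / 85 * (e * ‖w‖) := by
    apply mul_le_mul_of_nonneg_right hsm; positivity
  have hew0 : 0 ≤ e * ‖w‖ := mul_nonneg (by linarith) hw
  rw [abs_le]
  constructor <;> nlinarith

/-! ### One pass of the loop -/

theorem abs_norm_sub_one_le {E : Type*} [NormedAddCommGroup E] [NormedSpace ℝ E] {e b : ℝ}
    {w q : E} (he : 0 ≤ e) (hes : e ≤ 1 / 85) (hb : b ≠ 0) (hbw : |b - ‖w‖| ≤ 1.53 * e * ‖w‖)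
    (hq : ‖b • q - w‖ ≤ e * ‖w‖) : |‖q‖ - 1| ≤ 2.6 * e := by
  have hw := norm_nonneg w
  have hw0 : 0 < ‖w‖ := by
    refine lt_of_le_of_ne hw fun h0 => hb ?_
    rw [← h0] at hbw
    simpa using hbw
  rw [abs_le] at hbw
  have hew : e * ‖w‖ ≤ 1 / 85 * ‖w‖ := by gcongr
  have hbpos : 0 < b := by nlinarith
  have h1 := abs_norm_sub_norm_le (b • q) w
  rw [norm_smul, Real.norm_of_nonneg hbpos.le] at h1
  have h2 := abs_le.1 (h1.trans hq)
  have h3 : e * (e * ‖w‖) ≤ 1 / 85 * (e * ‖w‖) := by gcongr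
  have h4 : e * (1 - 1.53 * e) * ‖w‖ ≤ e * b := by nlinarith
  rw [abs_le]
  constructor
  · refine le_of_mul_le_mul_left ?_ hbpos
    nlinarith
  · refine le_of_mul_le_mul_left ?_ hbpos
    nlinarith

theorem abs_norm_sq_sub_one_le {E : Type*} [NormedAddCommGroup E] {e : ℝ} {q : E} (hes : e ≤ 1 / 85) (hq : |‖q‖ - 1| ≤ 2.6 * e) :
    |‖q‖ ^ 2 - 1| ≤ 5.281 * e := by
  have hq1 : ‖q‖ ≤ 1.031 := by have := (abs_le.1 hq).2; linarith
  have he : 0 ≤ e := by linarith [abs_nonneg (‖q‖ - 1)]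
  have h1 : ‖q‖ ^ 2 - 1 = (‖q‖ - 1) * (‖q‖ + 1) := by ring
  rw [h1, abs_mul, abs_of_nonneg (by positivity : 0 ≤ ‖q‖ + 1)]
  calc |‖q‖ - 1| * (‖q‖ + 1) ≤ (2.6 * e) * (1.031 + 1) := by gcongr
    _ ≤ _ := by linarith

/-- If `a` is nearly `⟪u, q⟫` and `q` is nearly normalized, then `u - a q` is nearly an orthogonal
projection of `u`, so its norm hardly exceeds that of `u`. -/
theorem norm_sub_smul_sq_le {E : Type*} [NormedAddCommGroup E] [InnerProductSpace ℝ E]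
    {u q : E} {a : ℝ} (hq : ‖q‖ ≤ 1.4) :
    ‖u - a • q‖ ^ 2 ≤ ‖u‖ ^ 2 + 2 * (|a| * |a - ⟪u, q⟫|) := by
  rw [norm_sub_sq_real, inner_smul_right, norm_smul, mul_pow, Real.norm_eq_abs, sq_abs]
  have h1 : a * (a - ⟪u, q⟫) ≤ |a| * |a - ⟪u, q⟫| := (le_abs_self _).trans (abs_mul _ _).le
  have h2 : ‖q‖ ^ 2 ≤ 2 := by
    calc ‖q‖ ^ 2 ≤ 1.4 ^ 2 := by gcongr
      _ ≤ 2 := by norm_num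
  have h3 : a ^ 2 * ‖q‖ ^ 2 ≤ a ^ 2 * 2 := by gcongr
  linarith

/-- What the error analysis yields about one pass of the loop, which turns `qp = q_{i-1}`, `q = q_i`
and `b = β_i` into `a = α_i`, `b' = β_{i+1}` and `q' = q_{i+1}`. Here `Aq` is the exact product, and
`ν`, `e` stand for `‖A‖` and `n^{3/2} ε`. -/
structure StepBounds {E : Type*} [NormedAddCommGroup E] [InnerProductSpace ℝ E] (e ν : ℝ)
    (Aq qp q q' : E) (b a b' : ℝ) : Prop where
  abs_diag : |a| ≤ 1.25 * ν
  abs_off : |b'| ≤ 1.25 * ν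
  residual : ‖Aq - (b' • q' + a • q + b • qp)‖ ≤ 8.2 * (e * ν)
  local_orth : |b' * ⟪q, q'⟫| ≤ 11.6 * (e * ν)
  norm_next : b' ≠ 0 → |‖q'‖ - 1| ≤ 2.6 * e

/-- Error analysis of one pass of the loop. The hypothesis `hu0` holds by the almost-orthogonality
of vectors two steps apart; it prevents the bounds from growing with the number of passes. -/
theorem stepBounds_of_perturbed {E : Type*} [NormedAddCommGroup E] [InnerProductSpace ℝ E]
    {e ν : ℝ} {Aq qp q q' p s u t w : E} {b a b' : ℝ} (he : 0 ≤ e) (hes : e ≤ 1 / 85)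
    (hν : 0 ≤ ν) (hq : |‖q‖ - 1| ≤ 2.6 * e) (hqp : ‖qp‖ ≤ 1 + 2.6 * e) (hb : |b| ≤ 1.25 * ν)
    (hu0 : ‖Aq - b • qp‖ ≤ 1.12 * ν)
    (hp : ‖p - Aq‖ ≤ 2 * ν * ‖q‖ * e) (hs : ‖s - b • qp‖ ≤ e * ‖b • qp‖)
    (hu : ‖u - (p - s)‖ ≤ e * ‖p - s‖) (ha : |a - ⟪u, q⟫| ≤ 1.02 * e * (‖u‖ * ‖q‖))
    (ht : ‖t - a • q‖ ≤ e * ‖a • q‖) (hw : ‖w - (u - t)‖ ≤ e * ‖u - t‖)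
    (hb' : |b' - ‖w‖| ≤ 1.53 * e * ‖w‖) (hq' : ‖b' • q' - w‖ ≤ e * ‖w‖) :
    StepBounds e ν Aq qp q q' b a b' := by
  have hq1 : ‖q‖ ≤ 1.031 := by have := (abs_le.1 hq).2; linarith
  have hqp1 : ‖qp‖ ≤ 1.031 := by linarith
  have heν : e * ν ≤ 1 / 85 * ν := by gcongr
  have heν0 : 0 ≤ e * ν := mul_nonneg he hν
  have kbq : ‖b • qp‖ ≤ 1.289 * ν := by
    rw [norm_smul, Real.norm_eq_abs]
    calc |b| * ‖qp‖ ≤ (1.25 * ν) * 1.031 := by gcongr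
      _ ≤ _ := by linarith
  have kp : ‖p - Aq‖ ≤ 2.062 * (e * ν) := by
    calc _ ≤ _ := hp
      _ ≤ 2 * ν * 1.031 * e := by gcongr
      _ = _ := by ring
  have ks : ‖s - b • qp‖ ≤ 1.289 * (e * ν) := by
    calc _ ≤ _ := hs
      _ ≤ e * (1.289 * ν) := by gcongr
      _ = _ := by ring
  have kps : ‖p - s‖ ≤ 1.16 * ν := by
    have h : p - s = (Aq - b • qp) + ((p - Aq) - (s - b • qp)) := by abel
    rw [h]
    have h1 := norm_add_le (Aq - b • qp) ((p - Aq) - (s - b • qp))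
    have h2 := norm_sub_le (p - Aq) (s - b • qp)
    linarith
  have ku : ‖u - (p - s)‖ ≤ 1.16 * (e * ν) := by
    calc _ ≤ _ := hu
      _ ≤ e * (1.16 * ν) := by gcongr
      _ = _ := by ring
  have kU : ‖u‖ ≤ 1.174 * ν := by
    have h1 := norm_add_le (u - (p - s)) (p - s)
    rw [sub_add_cancel] at h1
    linarith
  have ka : |a - ⟪u, q⟫| ≤ 1.235 * (e * ν) := by
    calc _ ≤ _ := ha
      _ ≤ 1.02 * e * ((1.174 * ν) * 1.031) := by gcongr
      _ = 1.02 * (1.174 * 1.031) * (e * ν) := by ring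
      _ ≤ _ := by gcongr; norm_num
  have kuq : |⟪u, q⟫| ≤ 1.2104 * ν := by
    calc _ ≤ _ := abs_real_inner_le_norm u q
      _ ≤ (1.174 * ν) * 1.031 := by gcongr
      _ ≤ _ := by linarith
  have kA : |a| ≤ 1.225 * ν := by
    have h1 := abs_add_le (a - ⟪u, q⟫) ⟪u, q⟫
    rw [sub_add_cancel] at h1
    linarith
  have kaq : ‖a • q‖ ≤ 1.263 * ν := by
    rw [norm_smul, Real.norm_eq_abs]
    calc |a| * ‖q‖ ≤ (1.225 * ν) * 1.031 := by gcongr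
      _ ≤ _ := by linarith
  have kt : ‖t - a • q‖ ≤ 1.263 * (e * ν) := by
    calc _ ≤ _ := ht
      _ ≤ e * (1.263 * ν) := by gcongr
      _ = _ := by ring
  have kρ := abs_norm_sq_sub_one_le hes hq
  have kuaq : ‖u - a • q‖ ≤ 1.19 * ν := by
    have h1 : ‖u‖ ^ 2 ≤ (1.174 * ν) ^ 2 := by gcongr
    have h2 : |a| * |a - ⟪u, q⟫| ≤ (1.225 * ν) * (1.235 * (e * ν)) := by gcongr
    have h3 : ν * (e * ν) ≤ ν * (1 / 85 * ν) := by gcongr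
    have h4 := sq_nonneg ν
    refine abs_le_of_sq_le_sq' ((norm_sub_smul_sq_le (by linarith)).trans ?_)
      (by positivity) |>.2
    linarith
  have kut : ‖u - t‖ ≤ 1.205 * ν := by
    have h : u - t = (u - a • q) - (t - a • q) := by abel
    rw [h]
    have := norm_sub_le (u - a • q) (t - a • q)
    linarith
  have kw : ‖w - (u - t)‖ ≤ 1.205 * (e * ν) := by
    calc _ ≤ _ := hw
      _ ≤ e * (1.205 * ν) := by gcongr
      _ = _ := by ring
  have kW : ‖w‖ ≤ 1.22 * ν := by
    have h1 := norm_add_le (w - (u - t)) (u - t)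
    rw [sub_add_cancel] at h1
    linarith
  have kq' : ‖b' • q' - w‖ ≤ 1.22 * (e * ν) := by
    calc _ ≤ _ := hq'
      _ ≤ e * (1.22 * ν) := by gcongr
      _ = _ := by ring
  refine ⟨by linarith, ?_, ?_, ?_, fun hb0 => abs_norm_sub_one_le he hes hb0 hb' hq'⟩
  · have h1 := abs_add_le (b' - ‖w‖) ‖w‖
    rw [sub_add_cancel, abs_of_nonneg (norm_nonneg w)] at h1
    have h2 : 1.53 * e * ‖w‖ ≤ 1.53 * e * (1.22 * ν) := by gcongr
    linarith
  · have h : Aq - (b' • q' + a • q + b • qp) = -((p - Aq) - (s - b • qp) + (u - (p - s))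
        - (t - a • q) + (w - (u - t)) + (b' • q' - w)) := by abel
    rw [h, norm_neg]
    have h1 := norm_add_le ((p - Aq) - (s - b • qp) + (u - (p - s)) - (t - a • q) + (w - (u - t)))
      (b' • q' - w)
    have h2 := norm_add_le ((p - Aq) - (s - b • qp) + (u - (p - s)) - (t - a • q)) (w - (u - t))
    have h3 := norm_sub_le ((p - Aq) - (s - b • qp) + (u - (p - s))) (t - a • q)
    have h4 := norm_add_le ((p - Aq) - (s - b • qp)) (u - (p - s))
    have h5 := norm_sub_le (p - Aq) (s - b • qp)
    linarith
  · set r : E := (w - (u - t)) + (b' • q' - w) - (t - a • q) with hr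
    have h : b' • q' = u - a • q + r := by rw [hr]; abel
    have hrn : ‖r‖ ≤ 3.688 * (e * ν) := by
      have h2 := norm_sub_le ((w - (u - t)) + (b' • q' - w)) (t - a • q)
      have h3 := norm_add_le (w - (u - t)) (b' • q' - w)
      linarith
    have h1 : b' * ⟪q, q'⟫ = -(a - ⟪u, q⟫) - a * (‖q‖ ^ 2 - 1) + ⟪q, r⟫ := by
      rw [← real_inner_smul_right, h, inner_add_right, inner_sub_right, inner_smul_right,
        real_inner_self_eq_norm_sq, real_inner_comm u q]
      ring
    have h2 : |⟪q, r⟫| ≤ 3.803 * (e * ν) := by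
      calc _ ≤ _ := abs_real_inner_le_norm q r
        _ ≤ 1.031 * (3.688 * (e * ν)) := by gcongr
        _ ≤ _ := by linarith
    have h3 : |a * (‖q‖ ^ 2 - 1)| ≤ 6.47 * (e * ν) := by
      rw [abs_mul]
      calc _ ≤ (1.225 * ν) * (5.281 * e) := by gcongr
        _ = 1.225 * 5.281 * (e * ν) := by ring
        _ ≤ _ := by gcongr; norm_num
    rw [h1, abs_le]
    rw [abs_le] at ka h2 h3
    constructor <;> linarith

/-! ### The bounds throughout a run -/

section Recurrence

variable {E : Type*} [NormedAddCommGroup E] [InnerProductSpace ℝ E]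

/-- Symmetry of `L` trades the inner product with `L q₂` for the recurrence at `q₁`. -/
theorem inner_symm_recurrence {L : E →ₗ[ℝ] E} (hL : L.IsSymmetric) (q₀ q₁ q₂ : E)
    (a₁ b₁ b₂ : ℝ) :
    b₂ * ⟪q₁, L q₂⟫ = b₂ ^ 2 * ‖q₂‖ ^ 2 + a₁ * (b₂ * ⟪q₁, q₂⟫) + b₁ * b₂ * ⟪q₀, q₂⟫
      + b₂ * ⟪L q₁ - (b₂ • q₂ + a₁ • q₁ + b₁ • q₀), q₂⟫ := by
  rw [← hL q₁ q₂, inner_sub_left, inner_add_left, inner_add_left, real_inner_smul_left,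
    real_inner_smul_left, real_inner_smul_left, real_inner_self_eq_norm_sq]
  ring

theorem StepBounds.abs_mul_inner_residual_le {e ν : ℝ} {L : E → E} {q₀ q₁ q₂ q : E}
    {a₁ b₁ b₂ b : ℝ} (h : StepBounds e ν (L q₁) q₀ q₁ q₂ b₁ a₁ b₂) (hν : 0 ≤ ν) (he : 0 ≤ e)
    (hb : |b| ≤ 1.25 * ν) (hq : ‖q‖ ≤ 1.031) :
    |b * ⟪L q₁ - (b₂ • q₂ + a₁ • q₁ + b₁ • q₀), q⟫| ≤ 10.57 * (e * ν ^ 2) := by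
  rw [abs_mul]
  calc _ ≤ (1.25 * ν) * ((8.2 * (e * ν)) * 1.031) := by
        gcongr
        exact (abs_real_inner_le_norm _ _).trans (by gcongr; exact h.residual)
    _ = 1.25 * 8.2 * 1.031 * (e * ν ^ 2) := by ring
    _ ≤ _ := by gcongr; norm_num

theorem StepBounds.abs_mul_local_orth_le {e ν : ℝ} {Aq qp q q' : E} {b a b' a' : ℝ}
    (h : StepBounds e ν Aq qp q q' b a b') (hν : 0 ≤ ν)
    (ha' : |a'| ≤ 1.25 * ν) : |a' * (b' * ⟪q, q'⟫)| ≤ 14.5 * (e * ν ^ 2) := by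
  rw [abs_mul]
  calc _ ≤ (1.25 * ν) * (11.6 * (e * ν)) := by gcongr; exact h.local_orth
    _ = _ := by ring

/-- The estimate that keeps the off-diagonal entries bounded: `β q_{i-1}` is nearly the component of
`L q_i` along `q_{i-1}`, so subtracting it hardly increases the norm. -/
theorem norm_apply_sub_smul_le {L : E →ₗ[ℝ] E} (hL : L.IsSymmetric) {e ν P : ℝ}
    (hLn : ∀ x, ‖L x‖ ≤ ν * ‖x‖) (he : 0 ≤ e) (hes : e ≤ 1 / 85) (hν : 0 ≤ ν)
    {q₀ q₁ q₂ : E} {a₁ b₁ b₂ : ℝ}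
    (h : StepBounds e ν (L q₁) q₀ q₁ q₂ b₁ a₁ b₂) (hq₁ : |‖q₁‖ - 1| ≤ 2.6 * e)
    (hq₂ : |‖q₂‖ - 1| ≤ 2.6 * e) (hP : |b₁ * b₂ * ⟪q₀, q₂⟫| ≤ P * (e * ν ^ 2))
    (hPe : (55.5 + 2 * P) * e ≤ 0.2544) :
    ‖L q₂ - b₂ • q₁‖ ≤ 1.12 * ν := by
  have r1 := abs_le.1 (abs_norm_sq_sub_one_le hes hq₁)
  have r2 := abs_le.1 (abs_norm_sq_sub_one_le hes hq₂)
  have hq21 : ‖q₂‖ ≤ 1.031 := by have := (abs_le.1 hq₂).2; linarith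
  have h1 := abs_le.1 (h.abs_mul_inner_residual_le hν he h.abs_off hq21)
  have h2 := abs_le.1 (h.abs_mul_local_orth_le hν h.abs_diag)
  rw [abs_le] at hP
  have h3 := inner_symm_recurrence hL q₀ q₁ q₂ a₁ b₁ b₂
  refine abs_le_of_sq_le_sq' ?_ (by positivity) |>.2
  rw [norm_sub_sq_real, inner_smul_right, real_inner_comm, norm_smul, mul_pow, Real.norm_eq_abs,
    sq_abs, h3]
  have h4 : ‖L q₂‖ ^ 2 ≤ ν ^ 2 * ‖q₂‖ ^ 2 := by
    rw [← mul_pow]; gcongr; exact hLn q₂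
  have h5 : ν ^ 2 * ‖q₂‖ ^ 2 ≤ ν ^ 2 * (1 + 5.281 * e) := by gcongr; linarith
  have h6 : 0 ≤ b₂ ^ 2 * (2 * ‖q₂‖ ^ 2 - ‖q₁‖ ^ 2) := by
    apply mul_nonneg (sq_nonneg _); linarith
  have h7 : ν ^ 2 * ((55.5 + 2 * P) * e) ≤ ν ^ 2 * 0.2544 := by gcongr
  have h8 : 0 ≤ e * ν ^ 2 := by positivity
  linarith

/-- The products `β_i β_{i+1} ⟪q_{i-1}, q_{i+1}⟫` change by a small amount from one step to the
next. -/
theorem abs_two_step_inner_le {L : E →ₗ[ℝ] E} (hL : L.IsSymmetric) {e ν P : ℝ}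
    (he : 0 ≤ e) (hes : e ≤ 1 / 85) (hν : 0 ≤ ν)
    {q₀ q₁ q₂ q₃ : E} {a₁ b₁ b₂ a₂ b₃ : ℝ}
    (h : StepBounds e ν (L q₁) q₀ q₁ q₂ b₁ a₁ b₂)
    (h' : StepBounds e ν (L q₂) q₁ q₂ q₃ b₂ a₂ b₃) (hq₁ : |‖q₁‖ - 1| ≤ 2.6 * e)
    (hq₂ : |‖q₂‖ - 1| ≤ 2.6 * e) (hP : |b₁ * b₂ * ⟪q₀, q₂⟫| ≤ P * (e * ν ^ 2)) :
    |b₂ * b₃ * ⟪q₁, q₃⟫| ≤ (P + 67) * (e * ν ^ 2) := by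
  have r1 := abs_le.1 (abs_norm_sq_sub_one_le hes hq₁)
  have r2 := abs_le.1 (abs_norm_sq_sub_one_le hes hq₂)
  have hq11 : ‖q₁‖ ≤ 1.031 := by have := (abs_le.1 hq₁).2; linarith
  have hq21 : ‖q₂‖ ≤ 1.031 := by have := (abs_le.1 hq₂).2; linarith
  have h1 := abs_le.1 (h.abs_mul_inner_residual_le hν he h.abs_off hq21)
  have h1' := abs_le.1 (h'.abs_mul_inner_residual_le hν he h.abs_off hq11)
  have h2 := abs_le.1 (h.abs_mul_local_orth_le hν h.abs_diag)
  have h2' := abs_le.1 (h.abs_mul_local_orth_le hν h'.abs_diag)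
  have h3 := inner_symm_recurrence hL q₀ q₁ q₂ a₁ b₁ b₂
  have h4 : b₂ * ⟪q₁, L q₂⟫ = b₂ * b₃ * ⟪q₁, q₃⟫ + a₂ * (b₂ * ⟪q₁, q₂⟫) + b₂ ^ 2 * ‖q₁‖ ^ 2
      + b₂ * ⟪L q₂ - (b₃ • q₃ + a₂ • q₂ + b₂ • q₁), q₁⟫ := by
    rw [inner_sub_left, inner_add_left, inner_add_left, real_inner_smul_left,
      real_inner_smul_left, real_inner_smul_left, real_inner_self_eq_norm_sq,
      real_inner_comm q₃ q₁, real_inner_comm q₂ q₁, real_inner_comm (L q₂) q₁]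
    ring
  have h5 : |b₂ ^ 2 * (‖q₂‖ ^ 2 - ‖q₁‖ ^ 2)| ≤ 16.51 * (e * ν ^ 2) := by
    rw [abs_mul, abs_pow]
    calc _ ≤ (1.25 * ν) ^ 2 * (10.562 * e) := by
          gcongr
          · exact h.abs_off
          · rw [abs_le]; constructor <;> linarith
      _ = 1.25 ^ 2 * 10.562 * (e * ν ^ 2) := by ring
      _ ≤ _ := by gcongr; norm_num
  rw [abs_le] at hP h5 ⊢
  have h8 : 0 ≤ e * ν ^ 2 := by positivity
  constructor <;> linarith

/-- The bounds of `StepBounds` hold throughout a run: the inner products of vectors two steps apart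
grow at most linearly with the number of steps, hence stay small as long as `e * m ^ 2` is. -/
theorem stepBounds_of_run {L : E →ₗ[ℝ] E} (hL : L.IsSymmetric) {e ν : ℝ}
    (hLn : ∀ x, ‖L x‖ ≤ ν * ‖x‖) (he : 0 ≤ e) (hν : 0 ≤ ν) {m : ℕ}
    (hm : e * (m : ℝ) ^ 2 ≤ 1 / 85) {q : ℕ → E} {α β : ℕ → ℝ} (hq₀ : q 0 = 0)
    (hq₁ : |‖q 1‖ - 1| ≤ 2.6 * e) (hβ : β 1 = 0) (hβ₀ : ∀ i, 1 ≤ i → i < m → β (i + 1) ≠ 0)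
    (hstep : ∀ i, i + 1 ≤ m → |‖q (i + 1)‖ - 1| ≤ 2.6 * e → ‖q i‖ ≤ 1 + 2.6 * e →
      |β (i + 1)| ≤ 1.25 * ν → ‖L (q (i + 1)) - β (i + 1) • q i‖ ≤ 1.12 * ν →
      StepBounds e ν (L (q (i + 1))) (q i) (q (i + 1)) (q (i + 2)) (β (i + 1)) (α (i + 1))
        (β (i + 2))) (i : ℕ) (hi : i + 1 ≤ m) :
    |‖q (i + 1)‖ - 1| ≤ 2.6 * e ∧ |β (i + 1)| ≤ 1.25 * ν ∧
      StepBounds e ν (L (q (i + 1))) (q i) (q (i + 1)) (q (i + 2)) (β (i + 1)) (α (i + 1))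
        (β (i + 2)) ∧
      |β (i + 1) * β (i + 2) * ⟪q i, q (i + 2)⟫| ≤ (67 * i) * (e * ν ^ 2) := by
  have hes : e ≤ 1 / 85 := by
    refine le_trans ?_ hm
    have : (1 : ℝ) ≤ (m : ℝ) ^ 2 := one_le_pow₀ (by exact_mod_cast (by omega : 1 ≤ m))
    nlinarith
  induction i with
  | zero =>
    refine ⟨hq₁, by rw [hβ, abs_zero]; positivity, hstep 0 hi hq₁ ?_ ?_ ?_, ?_⟩
    · rw [hq₀, norm_zero]; linarith
    · rw [hβ, abs_zero]; positivity
    · rw [hβ, zero_smul, sub_zero]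
      refine (hLn _).trans ?_
      rw [mul_comm]
      gcongr
      have := (abs_le.1 hq₁).2
      linarith
    · rw [hq₀]; simp
  | succ i ih =>
    obtain ⟨h1, h2, h3, h4⟩ := ih (by omega)
    have hq2 : |‖q (i + 2)‖ - 1| ≤ 2.6 * e := h3.norm_next (hβ₀ (i + 1) (by omega) (by omega))
    have hu : ‖L (q (i + 2)) - β (i + 2) • q (i + 1)‖ ≤ 1.12 * ν := by
      refine norm_apply_sub_smul_le hL hLn he hes hν h3 h1 hq2 h4 ?_
      have hm2 : e * ((i : ℝ) + 2) ^ 2 ≤ 1 / 85 := by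
        refine le_trans ?_ hm
        gcongr
        exact_mod_cast hi
      -- The quadratic `21.624 x² - 134 x + 212.5` has negative discriminant.
      have : 55.5 + 2 * (67 * (i : ℝ)) ≤ 21.624 * ((i : ℝ) + 2) ^ 2 := by
        nlinarith [sq_nonneg (((i : ℝ) + 2) - 3.1)]
      calc _ ≤ (21.624 * ((i : ℝ) + 2) ^ 2) * e := by gcongr
        _ ≤ _ := by linarith
    have h5 := hstep (i + 1) hi hq2 (by have := (abs_le.1 h1).2; linarith) h3.abs_off hu
    refine ⟨hq2, h3.abs_off, h5, ?_⟩
    have := abs_two_step_inner_le hL he hes hν h3 h5 h1 hq2 h4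
    push_cast
    linarith

end Recurrence

/-! ### Quadratic forms, resolvents and tridiagonal matrices -/

open Matrix

/-- An affine function that is nonnegative on the eigenvalues of `T` is nonnegative on the quadratic
form of `T`. -/
theorem dotProduct_mulVec_nonneg_of_eigenvalues {ι : Type*} [Fintype ι] [DecidableEq ι]
    {T : Matrix ι ι ℝ} (hT : T.IsHermitian) {a b : ℝ} (h : ∀ i, 0 ≤ a * hT.eigenvalues i + b)
    (v : ι → ℝ) : 0 ≤ a * (v ⬝ᵥ T *ᵥ v) + b * (v ⬝ᵥ v) := by
  have h1 : (a • T + b • (1 : Matrix ι ι ℝ)).PosSemidef := by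
    have hU : (hT.eigenvectorUnitary : Matrix ι ι ℝ) * (hT.eigenvectorUnitary : Matrix ι ι ℝ)ᴴ = 1 :=
      Unitary.coe_mul_star_self _
    have h2 : a • T + b • (1 : Matrix ι ι ℝ) = (hT.eigenvectorUnitary : Matrix ι ι ℝ) *
        diagonal (fun i => a * hT.eigenvalues i + b) *
          (hT.eigenvectorUnitary : Matrix ι ι ℝ)ᴴ := by
      have h3 : diagonal (fun i => a * hT.eigenvalues i + b) =
          a • diagonal hT.eigenvalues + b • (1 : Matrix ι ι ℝ) := by
        ext i j
        by_cases hij : i = j <;> simp [hij, one_apply]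
      rw [h3, mul_add, add_mul, mul_smul_comm, mul_smul_comm, mul_one, smul_mul_assoc,
        smul_mul_assoc, hU]
      congr 2
      conv_lhs => rw [hT.spectral_theorem]
      rfl
    rw [h2]
    exact (PosSemidef.diagonal fun i => h i).mul_mul_conjTranspose_same _
  have h2 := h1.dotProduct_mulVec_nonneg v
  rw [add_mulVec, dotProduct_add, smul_mulVec, smul_mulVec, one_mulVec, dotProduct_smul,
    dotProduct_smul] at h2
  simpa using h2

theorem dotProduct_mulVec_le_of_eigenvalues_le {ι : Type*} [Fintype ι] [DecidableEq ι]
    {T : Matrix ι ι ℝ} (hT : T.IsHermitian) {c : ℝ} (h : ∀ i, hT.eigenvalues i ≤ c) (v : ι → ℝ) :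
    v ⬝ᵥ T *ᵥ v ≤ c * (v ⬝ᵥ v) := by
  have := dotProduct_mulVec_nonneg_of_eigenvalues hT (a := -1) (b := c)
    (fun i => by linarith [h i]) v
  linarith

theorem le_dotProduct_mulVec_of_le_eigenvalues {ι : Type*} [Fintype ι] [DecidableEq ι]
    {T : Matrix ι ι ℝ} (hT : T.IsHermitian) {c : ℝ} (h : ∀ i, c ≤ hT.eigenvalues i) (v : ι → ℝ) :
    c * (v ⬝ᵥ v) ≤ v ⬝ᵥ T *ᵥ v := by
  have := dotProduct_mulVec_nonneg_of_eigenvalues hT (a := 1) (b := -c)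
    (fun i => by linarith [h i]) v
  linarith

theorem exists_eigenvalues_eq_dotProduct {ι : Type*} [Fintype ι] [DecidableEq ι]
    {T : Matrix ι ι ℝ} (hT : T.IsHermitian) (i : ι) :
    ∃ v : ι → ℝ, v ⬝ᵥ v = 1 ∧ v ⬝ᵥ T *ᵥ v = hT.eigenvalues i := by
  have h2 : (hT.eigenvectorBasis i).ofLp ⬝ᵥ (hT.eigenvectorBasis i).ofLp = 1 := by
    have h3 := EuclideanSpace.norm_sq_eq (hT.eigenvectorBasis i)
    rw [hT.eigenvectorBasis.norm_eq_one i] at h3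
    simpa [dotProduct, sq] using h3.symm
  refine ⟨_, h2, ?_⟩
  rw [hT.mulVec_eigenvectorBasis, dotProduct_smul, h2, smul_eq_mul, mul_one]

section Resolvent

variable {ι : Type*} [Fintype ι] [DecidableEq ι] {G : Matrix ι ι ℝ} {g : ℝ}

theorem isUnit_det_of_coercive (hg : 0 < g) (h : ∀ v, g * (v ⬝ᵥ v) ≤ v ⬝ᵥ G *ᵥ v) :
    IsUnit G.det := by
  rw [isUnit_iff_ne_zero]
  intro h0
  obtain ⟨v, hv, hv0⟩ := exists_mulVec_eq_zero_iff.2 h0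
  have h1 := h v
  rw [hv0, dotProduct_zero] at h1
  have h2 : 0 < v ⬝ᵥ v :=
    lt_of_le_of_ne (Finset.sum_nonneg fun i _ => mul_self_nonneg _)
      (Ne.symm (by simpa using hv))
  nlinarith

theorem sum_abs_inv_le_of_coercive (hg : 0 < g) (h : ∀ v, g * (v ⬝ᵥ v) ≤ v ⬝ᵥ G *ᵥ v) :
    ∑ j, ∑ i, |G⁻¹ i j| ≤ Fintype.card ι * √(Fintype.card ι) / g := by
  have key : ∀ j, ∑ i, |G⁻¹ i j| ≤ √(Fintype.card ι) / g := by
    intro j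
    set v : ι → ℝ := fun i => G⁻¹ i j with hv
    have hGv : G *ᵥ v = Pi.single j 1 := by
      have h1 : v = G⁻¹ *ᵥ Pi.single j 1 := by
        ext i; simp [hv]
      rw [h1, mulVec_mulVec, mul_nonsing_inv _ (isUnit_det_of_coercive hg h), one_mulVec]
    have h1 := h v
    rw [hGv, dotProduct_single_one] at h1
    have h2 : v j ^ 2 ≤ v ⬝ᵥ v := by
      rw [sq]
      exact Finset.single_le_sum (f := fun i => v i * v i) (fun i _ => mul_self_nonneg _)
        (Finset.mem_univ j)
    have h3 : (∑ i, |v i|) ^ 2 ≤ Fintype.card ι * (v ⬝ᵥ v) := by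
      have := sq_sum_le_card_mul_sum_sq (s := Finset.univ) (f := fun i => |v i|)
      simpa [dotProduct, sq] using this
    set N := v ⬝ᵥ v
    have hN : 0 ≤ N := (sq_nonneg _).trans h2
    have h4 : N ≤ (1 / g) ^ 2 := by
      have h5 : (g * N) ^ 2 ≤ N := by
        calc (g * N) ^ 2 ≤ v j ^ 2 := by gcongr
          _ ≤ N := h2
      rw [div_pow, one_pow, le_div_iff₀ (by positivity)]
      rcases hN.eq_or_lt with h0 | h0
      · rw [← h0]; simp
      · refine le_of_mul_le_mul_right ?_ h0
        linarith
    refine abs_le_of_sq_le_sq' ?_ (by positivity) |>.2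
    calc _ ≤ _ := h3
      _ ≤ Fintype.card ι * (1 / g) ^ 2 := by gcongr
      _ = (√(Fintype.card ι) / g) ^ 2 := by
        rw [div_pow, div_pow, Real.sq_sqrt (by positivity)]; ring
  calc _ ≤ ∑ _j : ι, √(Fintype.card ι) / g := Finset.sum_le_sum fun j _ => key j
    _ = _ := by simp [mul_div_assoc]

end Resolvent

section Tridiagonal

variable {s : ℕ} {α β : ℕ → ℝ}

theorem lanczosT_sum_mul (hβ : β 1 = 0) (g : ℕ → ℝ) (i : Fin s) :
    ∑ l : Fin s, lanczosT s α β i l * g (l + 1) =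
      β (i + 1) * g i + α (i + 1) * g (i + 1) +
        if (i : ℕ) + 1 = s then 0 else β (i + 2) * g (i + 2) := by
  have h1 : ∀ l : Fin s, lanczosT s α β i l * g (l + 1) =
      (if (l : ℕ) + 1 = i then β (i + 1) * g i else 0) +
      (if (l : ℕ) = i then α (i + 1) * g (i + 1) else 0) +
      (if (l : ℕ) = i + 1 then β (i + 2) * g (i + 2) else 0) := by
    obtain ⟨i, hi⟩ := i
    rintro ⟨l, hl⟩
    simp only [lanczosT, Matrix.of_apply]
    split_ifs <;> first | omega | (subst_vars; simp)
  rw [Finset.sum_congr rfl fun l _ => h1 l, Finset.sum_add_distrib, Finset.sum_add_distrib,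
    Fin.sum_univ_eq_sum_range (fun l => if l + 1 = (i : ℕ) then β (i + 1) * g i else 0),
    Fin.sum_univ_eq_sum_range (fun l => if l = (i : ℕ) then α (i + 1) * g (i + 1) else 0),
    Fin.sum_univ_eq_sum_range (fun l => if l = (i : ℕ) + 1 then β (i + 2) * g (i + 2) else 0)]
  have hi := i.2
  congr 1
  · congr 1
    · rcases Nat.eq_zero_or_pos (i : ℕ) with h0 | h0
      · simp [h0, hβ]
      · obtain ⟨l, hl⟩ : ∃ l, (i : ℕ) = l + 1 := ⟨i - 1, by omega⟩
        simp only [hl, add_left_inj, Finset.sum_ite_eq', Finset.mem_range]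
        rw [if_pos (by omega)]
    · simp
  · simp only [Finset.sum_ite_eq', Finset.mem_range]
    split_ifs <;> first | rfl | omega

end Tridiagonal

/-! ### The commutator with the Gram matrix -/

section Paige

variable {E : Type*} [NormedAddCommGroup E] [InnerProductSpace ℝ E]

/-- A Lanczos three-term recurrence for `L` that holds up to errors measured by `δ`. The vectors are
nearly normalized and consecutive ones nearly orthogonal; no global orthogonality is required. -/
structure ApproxLanczos (L : E →ₗ[ℝ] E) (m : ℕ) (q : ℕ → E) (α β : ℕ → ℝ) (δ : ℝ) : Prop where
  beta_one : β 1 = 0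
  residual : ∀ i, 1 ≤ i → i ≤ m →
    ‖L (q i) - (β (i + 1) • q (i + 1) + α i • q i + β i • q (i - 1))‖ ≤ 8.2 * δ
  local_orth : ∀ i, 1 ≤ i → i ≤ m → |β (i + 1) * ⟪q i, q (i + 1)⟫| ≤ 11.6 * δ
  norm_diff : ∀ i, 1 ≤ i → i + 1 ≤ m →
    |β (i + 1) * (‖q i‖ ^ 2 - ‖q (i + 1)‖ ^ 2)| ≤ 13.21 * δ
  norm_le : ∀ i, 1 ≤ i → i ≤ m → ‖q i‖ ≤ 1.031
  le_norm_sq : ∀ i, 1 ≤ i → i ≤ m → 0.93 ≤ ‖q i‖ ^ 2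

theorem ApproxLanczos.neg {L : E →ₗ[ℝ] E} {m : ℕ} {q : ℕ → E} {α β : ℕ → ℝ} {δ : ℝ}
    (h : ApproxLanczos L m q α β δ) : ApproxLanczos (-L) m q (-α) (-β) δ where
  beta_one := by simp [h.beta_one]
  residual i h1 h2 := by
    have e : (-L) (q i) - ((-β) (i + 1) • q (i + 1) + (-α) i • q i + (-β) i • q (i - 1)) =
        -(L (q i) - (β (i + 1) • q (i + 1) + α i • q i + β i • q (i - 1))) := by
      rw [LinearMap.neg_apply, Pi.neg_apply, Pi.neg_apply, Pi.neg_apply, neg_smul, neg_smul,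
        neg_smul]
      abel
    rw [e, norm_neg]
    exact h.residual i h1 h2
  local_orth i h1 h2 := by simpa using h.local_orth i h1 h2
  norm_diff i h1 h2 := by
    rw [Pi.neg_apply, neg_mul, abs_neg]
    exact h.norm_diff i h1 h2
  norm_le := h.norm_le
  le_norm_sq := h.le_norm_sq

theorem ApproxLanczos.mono {L : E →ₗ[ℝ] E} {m t : ℕ} {q : ℕ → E} {α β : ℕ → ℝ} {δ : ℝ}
    (h : ApproxLanczos L m q α β δ) (ht : t ≤ m) : ApproxLanczos L t q α β δ where
  beta_one := h.beta_one
  residual i h1 h2 := h.residual i h1 (h2.trans ht)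
  local_orth i h1 h2 := h.local_orth i h1 (h2.trans ht)
  norm_diff i h1 h2 := h.norm_diff i h1 (h2.trans ht)
  norm_le i h1 h2 := h.norm_le i h1 (h2.trans ht)
  le_norm_sq i h1 h2 := h.le_norm_sq i h1 (h2.trans ht)

/-- The strictly upper triangular part of the Gram matrix of the vectors `q i`. -/
noncomputable def upperGram (q : ℕ → E) (i j : ℕ) : ℝ := if i < j then ⟪q i, q j⟫ else 0

/-- The entry `(i, j)` of the commutator of the infinite tridiagonal matrix with diagonal `α` and
off-diagonal `β` and the strictly upper triangular part of the Gram matrix. It vanishes for exact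
Lanczos vectors. -/
noncomputable def commDefect (q : ℕ → E) (α β : ℕ → ℝ) (i j : ℕ) : ℝ :=
  (β i * upperGram q (i - 1) j + α i * upperGram q i j + β (i + 1) * upperGram q (i + 1) j) -
    (β j * upperGram q i (j - 1) + α j * upperGram q i j + β (j + 1) * upperGram q i (j + 1))

theorem ApproxLanczos.nonneg {L : E →ₗ[ℝ] E} {m : ℕ} {q : ℕ → E} {α β : ℕ → ℝ} {δ : ℝ}
    (h : ApproxLanczos L m q α β δ) (hm : 1 ≤ m) : 0 ≤ δ := by
  have := (abs_nonneg _).trans (h.local_orth 1 le_rfl hm)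
  linarith

theorem ApproxLanczos.abs_commDefect_le {L : E →ₗ[ℝ] E} (hL : L.IsSymmetric) {m : ℕ} {q : ℕ → E}
    {α β : ℕ → ℝ} {δ : ℝ} (h : ApproxLanczos L m q α β δ) {i j : ℕ} (hi : 1 ≤ i) (him : i ≤ m)
    (hj : 1 ≤ j) (hjm : j ≤ m) : |commDefect q α β i j| ≤ 31 * δ := by
  have hδ := h.nonneg (hi.trans him)
  obtain ⟨i, rfl⟩ : ∃ i', i = i' + 1 := ⟨i - 1, by omega⟩
  obtain ⟨j, rfl⟩ : ∃ j', j = j' + 1 := ⟨j - 1, by omega⟩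
  simp only [commDefect, upperGram, Nat.add_sub_cancel]
  rcases lt_trichotomy i j with hij | rfl | hij
  · rw [if_pos (by omega : i < j + 1), if_pos (by omega : i + 1 < j + 1),
      if_pos (by omega : i + 1 < j + 1 + 1)]
    have h1 := h.residual (i + 1) hi him
    have h2 := h.residual (j + 1) hj hjm
    set f := L (q (i + 1)) - (β (i + 1 + 1) • q (i + 1 + 1) + α (i + 1) • q (i + 1) +
      β (i + 1) • q (i + 1 - 1)) with hf
    set g := L (q (j + 1)) - (β (j + 1 + 1) • q (j + 1 + 1) + α (j + 1) • q (j + 1) +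
      β (j + 1) • q (j + 1 - 1)) with hg
    have k1 : |⟪f, q (j + 1)⟫| ≤ 8.4542 * δ := by
      calc _ ≤ _ := abs_real_inner_le_norm _ _
        _ ≤ (8.2 * δ) * 1.031 := by gcongr; exact h.norm_le _ hj hjm
        _ = _ := by ring
    have k2 : |⟪q (i + 1), g⟫| ≤ 8.4542 * δ := by
      calc _ ≤ _ := abs_real_inner_le_norm _ _
        _ ≤ 1.031 * (8.2 * δ) := by gcongr; exact h.norm_le _ hi him
        _ = _ := by ring
    have e1 : ⟪L (q (i + 1)), q (j + 1)⟫ = β (i + 2) * ⟪q (i + 2), q (j + 1)⟫ +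
        α (i + 1) * ⟪q (i + 1), q (j + 1)⟫ + β (i + 1) * ⟪q i, q (j + 1)⟫ + ⟪f, q (j + 1)⟫ := by
      rw [hf, inner_sub_left, inner_add_left, inner_add_left, real_inner_smul_left,
        real_inner_smul_left, real_inner_smul_left]
      simp only [Nat.add_sub_cancel]
      ring
    have e2 : ⟪q (i + 1), L (q (j + 1))⟫ = β (j + 2) * ⟪q (i + 1), q (j + 2)⟫ +
        α (j + 1) * ⟪q (i + 1), q (j + 1)⟫ + β (j + 1) * ⟪q (i + 1), q j⟫ + ⟪q (i + 1), g⟫ := by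
      rw [hg, inner_sub_right, inner_add_right, inner_add_right, real_inner_smul_right,
        real_inner_smul_right, real_inner_smul_right]
      simp only [Nat.add_sub_cancel]
      ring
    rw [hL, e2] at e1
    rw [abs_le] at k1 k2
    by_cases hij' : i + 1 = j
    · subst hij'
      rw [if_neg (by omega), if_neg (by omega)]
      have k3 := abs_le.1 (h.norm_diff (i + 1) hi hjm)
      rw [real_inner_self_eq_norm_sq, real_inner_self_eq_norm_sq] at e1
      rw [abs_le]
      constructor <;> linarith
    · rw [if_pos (by omega), if_pos (by omega), abs_le]
      constructor <;> linarith
  · rw [if_pos (by omega), if_neg (by omega), if_neg (by omega), if_neg (by omega),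
      if_pos (by omega)]
    have k1 := abs_le.1 (h.local_orth (i + 1) hi him)
    have k2 : |β (i + 1) * ⟪q i, q (i + 1)⟫| ≤ 11.6 * δ := by
      rcases Nat.eq_zero_or_pos i with rfl | h0
      · rw [h.beta_one, zero_mul, abs_zero]; linarith
      · exact h.local_orth i h0 (by omega)
    rw [abs_le] at k2 ⊢
    constructor <;> linarith
  · rw [if_neg (by omega), if_neg (by omega), if_neg (by omega), if_neg (by omega),
      if_neg (by omega)]
    simpa using hδ

/-- Taking the trace against a matrix that commutes with `T` eliminates the commutator of `T` and
the strictly upper triangular part of the Gram matrix. Only the last column, where `T` cuts off the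
three-term recurrence, and the defect remain. -/
theorem sum_mul_inner_eq_neg_sum_commDefect {q : ℕ → E} {α β : ℕ → ℝ} (hβ : β 1 = 0) {s : ℕ}
    {X : Matrix (Fin (s + 1)) (Fin (s + 1)) ℝ}
    (hX : X * lanczosT (s + 1) α β = lanczosT (s + 1) α β * X) :
    β (s + 2) * ∑ i, X (Fin.last s) i * ⟪q (i + 1), q (s + 2)⟫ =
      -∑ j, ∑ i, X j i * commDefect q α β (i + 1) (j + 1) := by
  set T := lanczosT (s + 1) α β with hT
  set R : Matrix (Fin (s + 1)) (Fin (s + 1)) ℝ :=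
    Matrix.of fun i j => upperGram q (i + 1) (j + 1) with hR
  have hsymm : ∀ i j, T i j = T j i := fun i j =>
    (lanczosT_isHermitian (s + 1) α β).apply j i
  have hTR : ∀ i j, (T * R) i j = β (i + 1) * upperGram q i (j + 1) +
      α (i + 1) * upperGram q (i + 1) (j + 1) + β (i + 2) * upperGram q (i + 2) (j + 1) := by
    intro i j
    rw [mul_apply]
    refine (lanczosT_sum_mul hβ (fun l => upperGram q l (j + 1)) i).trans ?_
    congr 1
    split_ifs with h
    · rw [upperGram, if_neg (by omega), mul_zero]
    · rfl
  have hRT : ∀ i j, (R * T) i j = β (j + 1) * upperGram q (i + 1) j +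
      α (j + 1) * upperGram q (i + 1) (j + 1) +
        if j = Fin.last s then 0 else β (j + 2) * upperGram q (i + 1) (j + 2) := by
    intro i j
    rw [mul_apply]
    have h1 : ∀ l, R i l * T l j = T j l * upperGram q (i + 1) (l + 1) := fun l => by
      rw [hsymm l j, mul_comm]; rfl
    rw [Finset.sum_congr rfl fun l _ => h1 l]
    refine (lanczosT_sum_mul hβ (fun l => upperGram q (i + 1) l) j).trans ?_
    congr 1
    have h2 : (j : ℕ) + 1 = s + 1 ↔ j = Fin.last s := by
      rw [Fin.ext_iff, Fin.val_last]; omega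
    simp only [h2]
  have hcomm : ∀ i j, (T * R - R * T) i j = commDefect q α β (i + 1) (j + 1) +
      if j = Fin.last s then β (s + 2) * ⟪q (i + 1), q (s + 2)⟫ else 0 := by
    intro i j
    rw [Matrix.sub_apply, hTR, hRT, commDefect]
    simp only [Nat.add_sub_cancel]
    split_ifs with h
    · subst h
      simp only [Fin.val_last]
      have : upperGram q (i + 1) (s + 1 + 1) = ⟪q (i + 1), q (s + 2)⟫ := by
        rw [upperGram, if_pos (by omega)]
      rw [this]
      ring
    · ring
  have htr : (X * (T * R - R * T)).trace = 0 := by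
    rw [mul_sub, trace_sub, ← mul_assoc, ← mul_assoc, hX, trace_mul_cycle X R T, sub_self]
  simp only [trace, diag_apply, mul_apply, hcomm, mul_add, mul_ite, mul_zero,
    Finset.sum_add_distrib] at htr
  rw [eq_neg_iff_add_eq_zero, add_comm, ← htr]
  congr 1
  rw [Finset.sum_comm, Finset.mul_sum]
  refine Finset.sum_congr rfl fun i _ => ?_
  rw [Finset.sum_ite_eq' Finset.univ (Fin.last s)
    (fun x => X x i * (β (s + 2) * ⟪q (i + 1), q (s + 2)⟫)), if_pos (Finset.mem_univ _)]
  ring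

end Paige

/-! ### An upper bound on the eigenvalues of `T` -/

section Paige

variable {E : Type*} [NormedAddCommGroup E] [InnerProductSpace ℝ E]

/-- If `y` satisfies the three-term recurrence of an eigenvector for `μ`, its first `s + 1` entries
are a multiple of the last column of the resolvent `(μ - T)⁻¹` of the leading submatrix `T`. The
resolvent commutes with `T`, so the inner product is a trace against the commutator defect, and it is
small when `μ` exceeds the spectrum of `T` by a gap `g`. -/
theorem ApproxLanczos.abs_mul_inner_le {L : E →ₗ[ℝ] E} (hL : L.IsSymmetric) {s : ℕ}
    {q : ℕ → E} {α β : ℕ → ℝ} {δ μ g : ℝ} (h : ApproxLanczos L (s + 1) q α β δ) (hg : 0 < g)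
    (hT : ∀ v : Fin (s + 1) → ℝ, v ⬝ᵥ lanczosT (s + 1) α β *ᵥ v ≤ (μ - g) * (v ⬝ᵥ v))
    {y : ℕ → ℝ}
    (hy : ∀ i ≤ s, β (i + 1) * y i + α (i + 1) * y (i + 1) + β (i + 2) * y (i + 2) =
      μ * y (i + 1)) :
    |y (s + 2) * ⟪∑ i ∈ Finset.range (s + 1), y (i + 1) • q (i + 1), q (s + 2)⟫| ≤
      31 * δ * ((s + 1) * √(s + 1) / g) * y (s + 2) ^ 2 := by
  set T := lanczosT (s + 1) α β with hTdef
  set G : Matrix (Fin (s + 1)) (Fin (s + 1)) ℝ := μ • 1 - T with hG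
  have hcoer : ∀ v, g * (v ⬝ᵥ v) ≤ v ⬝ᵥ G *ᵥ v := by
    intro v
    have := hT v
    rw [hG, sub_mulVec, dotProduct_sub, smul_mulVec, one_mulVec, dotProduct_smul, smul_eq_mul]
    linarith
  have hdet := isUnit_det_of_coercive hg hcoer
  have hsum := sum_abs_inv_le_of_coercive hg hcoer
  have hGT : G * T = T * G := by
    rw [hG, sub_mul, mul_sub, smul_mul_assoc, mul_smul_comm, one_mul, mul_one]
  have hGsymm : Gᵀ = G := by
    rw [hG, transpose_sub, transpose_smul, transpose_one]
    congr 1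
    exact lanczosT_isHermitian (s + 1) α β
  set X := G⁻¹ with hX
  have hXsymm : ∀ i j, X i j = X j i := fun i j => by
    conv_lhs => rw [hX, ← hGsymm, ← transpose_nonsing_inv]
    rfl
  have hXT : X * T = T * X := by
    calc X * T = X * T * (G * X) := by rw [mul_nonsing_inv _ hdet, mul_one]
      _ = X * (G * T) * X := by rw [hGT]; simp only [mul_assoc]
      _ = T * X := by rw [← mul_assoc X, nonsing_inv_mul _ hdet, one_mul]
  have hGy : G *ᵥ (fun i => y (i + 1)) = Pi.single (Fin.last s) (β (s + 2) * y (s + 2)) := by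
    ext i
    rw [hG, sub_mulVec, smul_mulVec, one_mulVec]
    have h1 : (T *ᵥ fun i => y (i + 1)) i = _ := lanczosT_sum_mul h.beta_one y i
    have h2 := hy i (by omega)
    rw [Pi.sub_apply, h1, Pi.smul_apply, smul_eq_mul, ← h2]
    by_cases hi : i = Fin.last s
    · subst hi
      simp
    · rw [Pi.single_eq_of_ne hi, if_neg]
      · ring
      · intro h3
        exact hi (Fin.ext (by rw [Fin.val_last]; omega))
  have hyX : ∀ i : Fin (s + 1), y (i + 1) = X (Fin.last s) i * (β (s + 2) * y (s + 2)) := by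
    intro i
    have h1 : (fun i : Fin (s + 1) => y (i + 1)) = X *ᵥ Pi.single (Fin.last s)
        (β (s + 2) * y (s + 2)) := by
      rw [← hGy, mulVec_mulVec, nonsing_inv_mul _ hdet, one_mulVec]
    have h2 := congrFun h1 i
    simp only [mulVec_single] at h2
    rw [h2, hXsymm]
    simp [mul_comm]
  have key : y (s + 2) * ⟪∑ i ∈ Finset.range (s + 1), y (i + 1) • q (i + 1), q (s + 2)⟫ =
      -(y (s + 2) ^ 2 * ∑ j, ∑ i, X j i * commDefect q α β (i + 1) (j + 1)) := by
    have h1 := sum_mul_inner_eq_neg_sum_commDefect (q := q) h.beta_one hXT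
    rw [← mul_neg, ← h1, sum_inner, ← Fin.sum_univ_eq_sum_range
      (fun i => ⟪y (i + 1) • q (i + 1), q (s + 2)⟫), Finset.mul_sum, Finset.mul_sum,
      Finset.mul_sum]
    refine Finset.sum_congr rfl fun i _ => ?_
    rw [real_inner_smul_left, hyX i]
    ring
  have hδ := h.nonneg (by omega)
  rw [key, abs_neg, abs_mul, abs_of_nonneg (sq_nonneg (y (s + 2))), mul_comm]
  refine mul_le_mul_of_nonneg_right ?_ (sq_nonneg _)
  calc |∑ j, ∑ i, X j i * commDefect q α β (i + 1) (j + 1)|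
      ≤ ∑ j, ∑ i, |X j i| * (31 * δ) := by
        refine (Finset.abs_sum_le_sum_abs _ _).trans (Finset.sum_le_sum fun j _ => ?_)
        refine (Finset.abs_sum_le_sum_abs _ _).trans (Finset.sum_le_sum fun i _ => ?_)
        rw [abs_mul]
        gcongr
        exact h.abs_commDefect_le hL (by omega) (by omega) (by omega) (by omega)
    _ = 31 * δ * ∑ j, ∑ i, |X j i| := by
        simp only [Finset.mul_sum, mul_comm]
    _ ≤ _ := by
        rw [Finset.sum_comm]
        gcongr
        simpa using hsum

/-- The Ritz vector of `y` is not too short if its successive increments are nearly orthogonal to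
the partial sums, relative to `y (s + 2) ^ 2`. -/
theorem ApproxLanczos.le_norm_sq_sum {L : E →ₗ[ℝ] E} {t : ℕ} {q : ℕ → E} {α β : ℕ → ℝ}
    {δ : ℝ} (h : ApproxLanczos L t q α β δ) {y : ℕ → ℝ}
    (hy : ∀ s, s + 2 ≤ t →
      |y (s + 2) * ⟪∑ i ∈ Finset.range (s + 1), y (i + 1) • q (i + 1), q (s + 2)⟫| ≤
        1 / 5 * y (s + 2) ^ 2) {s : ℕ} (hs : s ≤ t) :
    1 / 2 * ∑ i ∈ Finset.range s, y (i + 1) ^ 2 ≤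
      ‖∑ i ∈ Finset.range s, y (i + 1) • q (i + 1)‖ ^ 2 := by
  induction s with
  | zero => simp
  | succ s ih =>
    have h1 := ih (by omega)
    rw [Finset.sum_range_succ, Finset.sum_range_succ, norm_add_sq_real, inner_smul_right,
      norm_smul, mul_pow, Real.norm_eq_abs, sq_abs]
    have h2 : |y (s + 1) * ⟪∑ i ∈ Finset.range s, y (i + 1) • q (i + 1), q (s + 1)⟫| ≤
        1 / 5 * y (s + 1) ^ 2 := by
      rcases s with _ | s
      · simp; positivity
      · exact hy s hs
    have h3 : y (s + 1) ^ 2 * 0.93 ≤ y (s + 1) ^ 2 * ‖q (s + 1)‖ ^ 2 := by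
      gcongr
      exact h.le_norm_sq _ (by omega) hs
    have h4 := (abs_le.1 h2).1
    have h5 := sq_nonneg (y (s + 1))
    linarith

/-- A recurrence of vectors combined with coefficients that satisfy the transposed recurrence: only a
boundary term survives. -/
theorem sum_smul_three_term {q : ℕ → E} {α β y : ℕ → ℝ} {μ : ℝ} {t : ℕ} (hβ : β 1 = 0)
    (hy : ∀ i < t, β (i + 1) * y i + α (i + 1) * y (i + 1) + β (i + 2) * y (i + 2) =
      μ * y (i + 1)) (hyt : y (t + 1) = 0) :
    ∑ i ∈ Finset.range t,
        y (i + 1) • (β (i + 2) • q (i + 2) + α (i + 1) • q (i + 1) + β (i + 1) • q i) =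
      μ • ∑ i ∈ Finset.range t, y (i + 1) • q (i + 1) + (β (t + 1) * y t) • q (t + 1) := by
  -- Summation by parts, without the condition `y (t + 1) = 0`.
  have key : ∀ s ≤ t, ∑ i ∈ Finset.range s,
        y (i + 1) • (β (i + 2) • q (i + 2) + α (i + 1) • q (i + 1) + β (i + 1) • q i) =
      μ • ∑ i ∈ Finset.range s, y (i + 1) • q (i + 1) + (β (s + 1) * y s) • q (s + 1)
        - (β (s + 1) * y (s + 1)) • q s := by
    intro s hs
    induction s with
    | zero => simp [hβ]
    | succ s ih =>
      rw [Finset.sum_range_succ, Finset.sum_range_succ, ih (by omega), smul_add μ, smul_smul μ,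
        ← hy s (by omega)]
      module
  rw [key t le_rfl, hyt, mul_zero, zero_smul, sub_zero]

/-- An eigenvector of `T` whose Ritz vector is not too short yields, by its Rayleigh quotient, an
upper bound on the eigenvalue. -/
theorem ApproxLanczos.le_of_eigenvector {L : E →ₗ[ℝ] E} (hL : L.IsSymmetric) {lam : ℝ}
    (hlam : ∀ x, ⟪x, L x⟫ ≤ lam * ‖x‖ ^ 2) {s : ℕ} {q : ℕ → E} {α β y : ℕ → ℝ} {δ μ : ℝ}
    (h : ApproxLanczos L (s + 1) q α β δ)
    (hy : ∀ i ≤ s, β (i + 1) * y i + α (i + 1) * y (i + 1) + β (i + 2) * y (i + 2) =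
      μ * y (i + 1)) (hyt : y (s + 2) = 0)
    (hy0 : 0 < ∑ i ∈ Finset.range (s + 1), y (i + 1) ^ 2)
    (hz : 1 / 2 * ∑ i ∈ Finset.range (s + 1), y (i + 1) ^ 2 ≤
      ‖∑ i ∈ Finset.range (s + 1), y (i + 1) • q (i + 1)‖ ^ 2) :
    μ ≤ lam + δ * (62 * (s + 1) + 11.6 * √(s + 1)) := by
  have hδ := h.nonneg (by omega)
  set N := ∑ i ∈ Finset.range (s + 1), y (i + 1) ^ 2 with hN
  set z := ∑ i ∈ Finset.range (s + 1), y (i + 1) • q (i + 1) with hzdef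
  set f : ℕ → E := fun i =>
    L (q (i + 1)) - (β (i + 2) • q (i + 2) + α (i + 1) • q (i + 1) + β (i + 1) • q i) with hf
  have hsum : (∑ i ∈ Finset.range (s + 1), |y (i + 1)|) ^ 2 ≤ (s + 1) * N := by
    have := sq_sum_le_card_mul_sum_sq (s := Finset.range (s + 1)) (f := fun i => |y (i + 1)|)
    simpa using this
  have hLz : L z = μ • z + (β (s + 2) * y (s + 1)) • q (s + 2) +
      ∑ i ∈ Finset.range (s + 1), y (i + 1) • f i := by
    rw [hzdef, ← sum_smul_three_term h.beta_one (fun i hi => hy i (by omega)) hyt,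
      ← Finset.sum_add_distrib, map_sum]
    refine Finset.sum_congr rfl fun i _ => ?_
    rw [map_smul, ← smul_add, hf]
    simp
  have hF : ‖∑ i ∈ Finset.range (s + 1), y (i + 1) • f i‖ ≤
      8.2 * δ * ∑ i ∈ Finset.range (s + 1), |y (i + 1)| := by
    rw [Finset.mul_sum]
    refine (norm_sum_le _ _).trans (Finset.sum_le_sum fun i hi => ?_)
    rw [norm_smul, Real.norm_eq_abs, mul_comm]
    gcongr
    exact h.residual (i + 1) (by omega) (by have := Finset.mem_range.1 hi; omega)
  -- The term with `q (s + 2)` is an eigenvector's quadratic form of the commutator defect.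
  have hlast : |(β (s + 2) * y (s + 1)) * ⟪z, q (s + 2)⟫| ≤ 31 * δ * ((s + 1) * N) := by
    set X : Matrix (Fin (s + 1)) (Fin (s + 1)) ℝ :=
      vecMulVec (fun i => y (i + 1)) (fun i => y (i + 1)) with hX
    have hTy : lanczosT (s + 1) α β *ᵥ (fun i => y (i + 1)) =
        μ • fun i : Fin (s + 1) => y (i + 1) := by
      ext i
      have h1 : (lanczosT (s + 1) α β *ᵥ fun i => y (i + 1)) i = _ :=
        lanczosT_sum_mul h.beta_one y i
      rw [h1, Pi.smul_apply, smul_eq_mul, ← hy i (by omega)]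
      congr 1
      split_ifs with hi
      · have : (i : ℕ) = s := by omega
        rw [this, hyt, mul_zero]
      · rfl
    have hT : (lanczosT (s + 1) α β)ᵀ = lanczosT (s + 1) α β := lanczosT_isHermitian _ _ _
    have hXT : X * lanczosT (s + 1) α β = lanczosT (s + 1) α β * X := by
      rw [hX, mul_vecMulVec, hTy, vecMulVec_mul, ← hT, vecMul_transpose, hTy, smul_vecMulVec,
        vecMulVec_smul]
    have h1 := sum_mul_inner_eq_neg_sum_commDefect (q := q) h.beta_one hXT
    have h2 : (β (s + 2) * y (s + 1)) * ⟪z, q (s + 2)⟫ =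
        β (s + 2) * ∑ i, X (Fin.last s) i * ⟪q (i + 1), q (s + 2)⟫ := by
      rw [hzdef, sum_inner, ← Fin.sum_univ_eq_sum_range
        (fun i => ⟪y (i + 1) • q (i + 1), q (s + 2)⟫), Finset.mul_sum, Finset.mul_sum]
      refine Finset.sum_congr rfl fun i _ => ?_
      rw [real_inner_smul_left, hX, vecMulVec_apply, Fin.val_last]
      ring
    rw [h2, h1, abs_neg]
    calc |∑ j, ∑ i, X j i * commDefect q α β (i + 1) (j + 1)|
        ≤ ∑ j : Fin (s + 1), ∑ i : Fin (s + 1), |y (j + 1)| * |y (i + 1)| * (31 * δ) := by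
          refine (Finset.abs_sum_le_sum_abs _ _).trans (Finset.sum_le_sum fun j _ => ?_)
          refine (Finset.abs_sum_le_sum_abs _ _).trans (Finset.sum_le_sum fun i _ => ?_)
          rw [abs_mul, hX, vecMulVec_apply, abs_mul]
          gcongr
          exact h.abs_commDefect_le hL (by omega) (by omega) (by omega) (by omega)
      _ = 31 * δ * (∑ i ∈ Finset.range (s + 1), |y (i + 1)|) ^ 2 := by
          rw [← Fin.sum_univ_eq_sum_range (fun i => |y (i + 1)|), sq, Finset.sum_mul_sum,
            Finset.mul_sum]
          refine Finset.sum_congr rfl fun j _ => ?_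
          rw [Finset.mul_sum]
          exact Finset.sum_congr rfl fun i _ => by ring
      _ ≤ _ := by gcongr
  have hquad : ⟪z, L z⟫ = μ * ‖z‖ ^ 2 + (β (s + 2) * y (s + 1)) * ⟪z, q (s + 2)⟫ +
      ⟪z, ∑ i ∈ Finset.range (s + 1), y (i + 1) • f i⟫ := by
    conv_lhs => rw [hLz]
    rw [inner_add_right, inner_add_right, inner_smul_right, inner_smul_right,
      real_inner_self_eq_norm_sq]
  -- The factor `1.41422` is `√2` rounded up.
  have hroot : ∑ i ∈ Finset.range (s + 1), |y (i + 1)| ≤ √(s + 1) * (1.41422 * ‖z‖) := by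
    refine abs_le_of_sq_le_sq' ?_ (by positivity) |>.2
    rw [mul_pow, Real.sq_sqrt (by positivity)]
    calc _ ≤ _ := hsum
      _ ≤ _ := by gcongr; nlinarith
  have hin : |⟪z, ∑ i ∈ Finset.range (s + 1), y (i + 1) • f i⟫| ≤
      11.6 * δ * √(s + 1) * ‖z‖ ^ 2 := by
    calc _ ≤ _ := abs_real_inner_le_norm _ _
      _ ≤ ‖z‖ * (8.2 * δ * (√(s + 1) * (1.41422 * ‖z‖))) := by
          gcongr
          exact hF.trans (by gcongr)
      _ = (8.2 * 1.41422) * δ * √(s + 1) * ‖z‖ ^ 2 := by ring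
      _ ≤ _ := by gcongr; norm_num
  have h1 := hlam z
  have h2 : 31 * δ * ((s + 1) * N) ≤ 31 * δ * ((s + 1) * (2 * ‖z‖ ^ 2)) := by
    gcongr; linarith
  have hz0 : 0 < ‖z‖ ^ 2 := by linarith
  rw [abs_le] at hlast hin
  refine le_of_mul_le_mul_right ?_ hz0
  linarith

/-- The bound on the eigenvalues of `T`, by strong induction on its size. If the top eigenvalue of
`T` exceeds those of all leading submatrices by enough, its Ritz vector is long and the Rayleigh
quotient bounds it; otherwise the bound for a smaller matrix applies. -/
theorem ApproxLanczos.quadForm_le {L : E →ₗ[ℝ] E} (hL : L.IsSymmetric) {lam : ℝ}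
    (hlam : ∀ x, ⟪x, L x⟫ ≤ lam * ‖x‖ ^ 2) {m : ℕ} {q : ℕ → E} {α β : ℕ → ℝ} {δ : ℝ}
    (h : ApproxLanczos L m q α β δ) (s : ℕ) (hs : s + 1 ≤ m) (v : Fin (s + 1) → ℝ) :
    v ⬝ᵥ lanczosT (s + 1) α β *ᵥ v ≤
      (lam + δ * (77.5 * √m * ((s + 1) * s) + 62 * m + 11.6 * √m)) * (v ⬝ᵥ v) := by
  induction s using Nat.strong_induction_on with
  | _ s ih =>
  have hδ := h.nonneg (by omega)
  refine dotProduct_mulVec_le_of_eigenvalues_le (lanczosT_isHermitian (s + 1) α β)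
    (fun i₀ => ?_) v
  set hT := lanczosT_isHermitian (s + 1) α β
  set μ := hT.eigenvalues i₀ with hμ
  by_contra! hcon
  set Y : Fin (s + 1) → ℝ := (hT.eigenvectorBasis i₀).ofLp with hY
  have hTY : lanczosT (s + 1) α β *ᵥ Y = μ • Y := hT.mulVec_eigenvectorBasis i₀
  -- Extending the eigenvector by zero makes the last row look like the others.
  set y : ℕ → ℝ := fun l => if hl : 1 ≤ l ∧ l ≤ s + 1 then Y ⟨l - 1, by omega⟩ else 0 with hy
  have hyY : ∀ i : Fin (s + 1), y (i + 1) = Y i := fun i => by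
    simp only [hy]
    rw [dif_pos (by omega)]
    rfl
  have hyt : y (s + 2) = 0 := by
    simp only [hy]
    rw [dif_neg (by omega)]
  have hrec : ∀ i ≤ s, β (i + 1) * y i + α (i + 1) * y (i + 1) + β (i + 2) * y (i + 2) =
      μ * y (i + 1) := by
    intro i hi
    have h1 := congrFun hTY ⟨i, by omega⟩
    rw [show Y = fun i : Fin (s + 1) => y (i + 1) from funext fun i => (hyY i).symm] at h1
    rw [Pi.smul_apply, smul_eq_mul] at h1
    rw [← h1]
    refine Eq.trans ?_ (lanczosT_sum_mul h.beta_one y ⟨i, by omega⟩).symm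
    congr 1
    split_ifs with h2
    · have : i = s := by simpa using h2
      rw [this, hyt, mul_zero]
    · rfl
  have hy0 : 0 < ∑ i ∈ Finset.range (s + 1), y (i + 1) ^ 2 := by
    rw [← Fin.sum_univ_eq_sum_range (fun i => y (i + 1) ^ 2)]
    simp only [hyY]
    have h1 : ‖hT.eigenvectorBasis i₀‖ = 1 := hT.eigenvectorBasis.norm_eq_one i₀
    have h2 := EuclideanSpace.norm_sq_eq (hT.eigenvectorBasis i₀)
    rw [h1] at h2
    simp only [Real.norm_eq_abs, sq_abs] at h2
    rw [hY, ← h2]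
    norm_num
  have hsm : √((s : ℝ) + 1) ≤ √m := Real.sqrt_le_sqrt (by exact_mod_cast hs)
  have hz := (h.mono hs).le_norm_sq_sum (y := y) (fun t ht => ?_) le_rfl
  · have h1 := (h.mono hs).le_of_eigenvector hL hlam hrec hyt hy0 hz
    have h2 : δ * (62 * (s + 1) + 11.6 * √(s + 1)) ≤
        δ * (77.5 * √m * ((s + 1) * s) + 62 * m + 11.6 * √m) := by
      gcongr
      have : (0 : ℝ) ≤ 77.5 * √m * ((s + 1) * s) := by positivity
      have : ((s : ℝ) + 1) ≤ m := by exact_mod_cast hs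
      linarith
    linarith
  · -- The gap between `μ` and the bound for the next smaller matrix.
    set g := μ - (lam + δ * (77.5 * √m * (s * (s - 1)) + 62 * m + 11.6 * √m)) with hg
    have hgle : 155 * (δ * (√m * s)) ≤ g := by rw [hg]; linarith
    have hgpos : 0 < g := by
      have : 0 ≤ δ * (√m * s) := by positivity
      rw [hg]
      linarith
    have hts : (t : ℝ) + 1 ≤ s := by exact_mod_cast (by omega : t + 1 ≤ s)
    refine ((h.mono (by omega : t + 1 ≤ m)).abs_mul_inner_le hL hgpos (μ := μ) (fun w => ?_)
      (fun i hi => hrec i (by omega))).trans ?_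
    · refine (ih t (by omega) (by omega) w).trans ?_
      refine mul_le_mul_of_nonneg_right ?_ (Finset.sum_nonneg fun i _ => mul_self_nonneg _)
      rw [hg, sub_sub_cancel]
      gcongr
      linarith
    · refine mul_le_mul_of_nonneg_right ?_ (sq_nonneg _)
      rw [← mul_div_assoc, div_le_iff₀ hgpos]
      have h1 : √((t : ℝ) + 1) ≤ √m :=
        Real.sqrt_le_sqrt (by exact_mod_cast (by omega : t + 1 ≤ m))
      calc 31 * δ * ((t + 1) * √(t + 1)) ≤ 31 * δ * (s * √m) := by gcongr
        _ ≤ _ := by linarith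

end Paige

/-! ### From floating-point runs to approximate recurrences -/

section Run

variable {n : ℕ} {A : Matrix (Fin n) (Fin n) ℝ}

theorem norm_toEuclideanLin_le (A : Matrix (Fin n) (Fin n) ℝ) (x : EuclideanSpace ℝ (Fin n)) :
    ‖toEuclideanLin A x‖ ≤ ‖A‖ * ‖x‖ :=
  l2_opNorm_mulVec A x

theorem inner_toEuclideanLin (A : Matrix (Fin n) (Fin n) ℝ) (x : EuclideanSpace ℝ (Fin n)) :
    ⟪x, toEuclideanLin A x⟫ = x.ofLp ⬝ᵥ A *ᵥ x.ofLp := by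
  rw [EuclideanSpace.inner_eq_star_dotProduct, star_trivial, dotProduct_comm]
  rfl

theorem norm_sq_eq_dotProduct (x : EuclideanSpace ℝ (Fin n)) :
    ‖x‖ ^ 2 = x.ofLp ⬝ᵥ x.ofLp := by
  rw [EuclideanSpace.norm_sq_eq]
  simp [dotProduct, sq]

/-- Normalizing `w` in floating point. If the computed norm `b` is zero then so is `w`, and `q` may be
arbitrary. -/
theorem norm_smul_sub_le_of_roundsTo {ε e b : ℝ} (h : SmallPrecision n ε e)
    {w q : EuclideanSpace ℝ (Fin n)} (hb : |b - ‖w‖| ≤ 1.53 * e * ‖w‖)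
    (hq : b ≠ 0 → ∀ j, RoundsTo ε (w j / b) (q j)) : ‖b • q - w‖ ≤ e * ‖w‖ := by
  rcases eq_or_ne b 0 with rfl | h0
  · rw [zero_sub, abs_neg, abs_of_nonneg (norm_nonneg _)] at hb
    have : ‖w‖ = 0 := by
      have := h.small
      nlinarith [norm_nonneg w]
    rw [zero_smul, zero_sub, norm_neg, this, mul_zero]
  · refine (norm_sub_le_of_roundsTo h.nonneg (z := w) (c := b • q) fun j => ?_).trans
      (by gcongr; exact h.le)
    obtain ⟨δ, hδ, hδ'⟩ := hq h0 j
    refine ⟨δ, hδ, ?_⟩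
    rw [PiLp.smul_apply, smul_eq_mul, hδ']
    field_simp

theorem LanczosStep.stepBounds {ε e : ℝ} (h : SmallPrecision n ε e)
    (he : e = (n : ℝ) ^ (3 / 2 : ℝ) * ε) {qp q q' : EuclideanSpace ℝ (Fin n)} {b a b' : ℝ}
    (hs : LanczosStep ε A qp q b a b' q') (hq : |‖q‖ - 1| ≤ 2.6 * e) (hqp : ‖qp‖ ≤ 1 + 2.6 * e)
    (hb : |b| ≤ 1.25 * ‖A‖) (hu0 : ‖toEuclideanLin A q - b • qp‖ ≤ 1.12 * ‖A‖) :
    StepBounds e ‖A‖ (toEuclideanLin A q) qp q q' b a b' := by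
  obtain ⟨p, s, u, t, w, hp, hs, hu, ha, ht, hw, hn, hq'⟩ := hs
  have hε := h.nonneg
  have hn' := hn.abs_sub_norm_le h
  refine stepBounds_of_perturbed (p := p) (s := s) (u := u) (t := t) (w := w)
    (hε.trans h.le) h.small (norm_nonneg _) hq hqp hb hu0 ?_ ?_ ?_ ?_ ?_ ?_ hn'
    (norm_smul_sub_le_of_roundsTo h hn' hq')
  · refine (show ‖p - toEuclideanLin A q‖ ≤ _ from hp).trans (le_of_eq ?_)
    rw [he]; ring
  · exact (norm_sub_le_of_roundsTo hε (z := b • qp) hs).trans (by gcongr; exact h.le)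
  · exact (norm_sub_le_of_roundsTo hε (z := p - s) hu).trans (by gcongr; exact h.le)
  · exact (ha.abs_sub_inner_le hε).trans (by gcongr; exact h.pow_le)
  · exact (norm_sub_le_of_roundsTo hε (z := a • q) ht).trans (by gcongr; exact h.le)
  · exact (norm_sub_le_of_roundsTo hε (z := u - t) hw).trans (by gcongr; exact h.le)

theorem LanczosRun.approxLanczos {ε e : ℝ} (h : SmallPrecision n ε e)
    (he : e = (n : ℝ) ^ (3 / 2 : ℝ) * ε) (hA : A.IsHermitian) {x : EuclideanSpace ℝ (Fin n)}
    (hx : x ≠ 0) {k m : ℕ} {q : ℕ → EuclideanSpace ℝ (Fin n)} {α β : ℕ → ℝ}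
    (hrun : LanczosRun ε A x k m q α β) (hk : e * (k : ℝ) ^ 2 ≤ 1 / 85) :
    ApproxLanczos (toEuclideanLin A) m q α β (e * ‖A‖) := by
  have he0 : 0 ≤ e := h.nonneg.trans h.le
  have hL : (toEuclideanLin A).IsSymmetric := isSymmetric_toEuclideanLin_iff.2 hA
  have hq₁ : |‖q 1‖ - 1| ≤ 2.6 * e := by
    obtain ⟨b, hb, hq⟩ := hrun.q_one
    have hb' := hb.abs_sub_norm_le h
    have hb0 : b ≠ 0 := by
      rintro rfl
      rw [zero_sub, abs_neg, abs_of_nonneg (norm_nonneg _)] at hb'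
      have := h.small
      nlinarith [norm_pos_iff.2 hx]
    exact abs_norm_sub_one_le he0 h.small hb0 hb'
      (norm_smul_sub_le_of_roundsTo h hb' fun _ => hq)
  have hm : e * (m : ℝ) ^ 2 ≤ 1 / 85 := by
    refine le_trans ?_ hk
    gcongr
    exact_mod_cast hrun.le_k
  have key := stepBounds_of_run hL (norm_toEuclideanLin_le A) he0 (norm_nonneg A) hm hrun.q_zero
    hq₁ hrun.beta_one hrun.not_stopped (α := α) fun i hi h1 h2 h3 h4 =>
      (hrun.step (i + 1) (by omega) hi).stepBounds h he h1 h2 h3 h4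
  have hsmall := h.small
  refine ⟨hrun.beta_one, fun i h1 h2 => ?_, fun i h1 h2 => ?_, fun i h1 h2 => ?_,
    fun i h1 h2 => ?_, fun i h1 h2 => ?_⟩ <;>
  obtain ⟨i, rfl⟩ : ∃ i', i = i' + 1 := ⟨i - 1, by omega⟩
  · exact (key i h2).2.2.1.residual
  · exact (key i h2).2.2.1.local_orth
  · have r1 := abs_le.1 (abs_norm_sq_sub_one_le hsmall (key i (by omega)).1)
    have r2 := abs_le.1 (abs_norm_sq_sub_one_le hsmall (key (i + 1) h2).1)
    rw [abs_mul]
    calc _ ≤ (1.25 * ‖A‖) * (10.562 * e) := by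
          gcongr
          · exact (key i (by omega)).2.2.1.abs_off
          · rw [abs_le]; constructor <;> linarith
      _ = (1.25 * 10.562) * (e * ‖A‖) := by ring
      _ ≤ _ := by gcongr; norm_num
  · have := (abs_le.1 (key i h2).1).2
    linarith
  · have := (abs_le.1 (abs_norm_sq_sub_one_le hsmall (key i h2).1)).1
    linarith

theorem lanczosT_neg (m : ℕ) (α β : ℕ → ℝ) : lanczosT m (-α) (-β) = -lanczosT m α β := by
  ext i j
  simp only [lanczosT, Matrix.of_apply, Matrix.neg_apply, Pi.neg_apply]
  split_ifs <;> simp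

theorem eigenvalue_bound_numeric {x : ℝ} (hx : 1 ≤ x) :
    77.5 * x * (x ^ 2 * (x ^ 2 - 1)) + 62 * x ^ 2 + 11.6 * x ≤ 85 * x ^ 5 := by
  have h1 : x ≤ x ^ 2 := by nlinarith
  have h2 : x ^ 2 ≤ x ^ 3 := by nlinarith [sq_nonneg x]
  have h3 : 0 ≤ x ^ 5 := by positivity
  nlinarith

/-- The eigenvalues of the computed `T` lie in the spectral interval of `A` widened by `η`. -/
theorem ApproxLanczos.eigenvalues_mem {m k : ℕ} (hA : A.IsHermitian)
    {q : ℕ → EuclideanSpace ℝ (Fin n)} {α β : ℕ → ℝ} {δ η : ℝ} (hm : 1 ≤ m) (hmk : m ≤ k)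
    (h : ApproxLanczos (toEuclideanLin A) m q α β δ) (hη : 85 * δ * (k : ℝ) ^ (5 / 2 : ℝ) ≤ η)
    (i : Fin m) : (lanczosT_isHermitian m α β).eigenvalues i ∈
      Set.Icc (lamMin hA - η) (lamMax hA + η) := by
  obtain ⟨s, rfl⟩ : ∃ s, m = s + 1 := ⟨m - 1, by omega⟩
  have hδ := h.nonneg hm
  have hL : (toEuclideanLin A).IsSymmetric := isSymmetric_toEuclideanLin_iff.2 hA
  have hL' : (-toEuclideanLin A).IsSymmetric := fun x y => by
    simp only [LinearMap.neg_apply, inner_neg_left, inner_neg_right, hL x y]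
  have hmax : ∀ x, ⟪x, toEuclideanLin A x⟫ ≤ lamMax hA * ‖x‖ ^ 2 := fun x => by
    rw [inner_toEuclideanLin, norm_sq_eq_dotProduct]
    exact dotProduct_mulVec_le_of_eigenvalues_le hA
      (fun i => le_ciSup (Set.finite_range _).bddAbove i) _
  have hmin : ∀ x, ⟪x, (-toEuclideanLin A) x⟫ ≤ -lamMin hA * ‖x‖ ^ 2 := fun x => by
    have := le_dotProduct_mulVec_of_le_eigenvalues hA
      (fun i => ciInf_le (Set.finite_range _).bddBelow i) x.ofLp
    rw [LinearMap.neg_apply, inner_neg_right, inner_toEuclideanLin, norm_sq_eq_dotProduct,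
      neg_mul, neg_le_neg_iff]
    exact this
  have hnum : δ * (77.5 * √((s + 1 : ℕ) : ℝ) * ((s + 1) * s) + 62 * ((s + 1 : ℕ) : ℝ) +
      11.6 * √((s + 1 : ℕ) : ℝ)) ≤ η := by
    refine le_trans ?_ hη
    have h1 : (1 : ℝ) ≤ √((s + 1 : ℕ) : ℝ) := Real.one_le_sqrt.2 (by push_cast; linarith)
    have h2 : √((s + 1 : ℕ) : ℝ) ^ 2 = (s : ℝ) + 1 := by
      rw [Real.sq_sqrt (by positivity)]; push_cast; ring
    have h3 : √((s + 1 : ℕ) : ℝ) ^ 5 ≤ (k : ℝ) ^ (5 / 2 : ℝ) := by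
      rw [Real.sqrt_eq_rpow, ← Real.rpow_natCast, ← Real.rpow_mul (by positivity)]
      norm_num only
      gcongr
    have h4 := eigenvalue_bound_numeric h1
    rw [h2, add_sub_cancel_right] at h4
    push_cast at h3 h4 ⊢
    calc _ ≤ δ * (85 * √((s : ℝ) + 1) ^ 5) := by gcongr
      _ ≤ δ * (85 * (k : ℝ) ^ (5 / 2 : ℝ)) := by gcongr
      _ = _ := by ring
  -- The lower bound is the upper bound for `-A`, whose recurrence has coefficients `-α`, `-β`.
  obtain ⟨v, hv1, hv2⟩ := exists_eigenvalues_eq_dotProduct (lanczosT_isHermitian (s + 1) α β) i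
  have hup := h.quadForm_le hL hmax s le_rfl v
  have hlo := h.neg.quadForm_le hL' hmin s le_rfl v
  rw [lanczosT_neg, neg_mulVec, dotProduct_neg, hv1, hv2] at hlo
  rw [hv1, hv2] at hup
  constructor <;> linarith

end Run

/-! ### Chebyshev polynomials -/

open Polynomial Polynomial.Chebyshev

section Chebyshev

theorem abs_eval_U_real_le (j : ℕ) {x : ℝ} (hx : |x| ≤ 1) : |(U ℝ j).eval x| ≤ j + 1 := by
  induction j with
  | zero => simp
  | succ j ih =>
    have h1 : (U ℝ ((j + 1 : ℕ) : ℤ)).eval x = x * (U ℝ j).eval x + (T ℝ (j + 1)).eval x := by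
      push_cast
      rw [U_eq_X_mul_U_add_T, eval_add, eval_mul, eval_X]
    rw [h1]
    have h2 := abs_eval_T_real_le_one ((j : ℤ) + 1) hx
    have h3 : |x| * |(U ℝ j).eval x| ≤ 1 * (j + 1) := by gcongr
    have h4 := abs_add_le (x * (U ℝ j).eval x) ((T ℝ (j + 1)).eval x)
    rw [abs_mul] at h4
    push_cast
    linarith

theorem exists_eq_sum_T {k : ℕ} {p : ℝ[X]} (hp : p.degree < k) :
    ∃ c : ℕ → ℝ, p = ∑ i ∈ Finset.range k, c i • T ℝ i := by
  induction k generalizing p with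
  | zero =>
    refine ⟨0, ?_⟩
    have : p = 0 := by simpa using hp
    simpa using this
  | succ k ih =>
    have hlead : (T ℝ k).coeff k ≠ 0 := by
      have h1 : (T ℝ k).natDegree = k := by rw [natDegree_T]; simp
      have h2 : (T ℝ k).leadingCoeff ≠ 0 := leadingCoeff_ne_zero.2 (T_ne_zero _ _)
      rwa [leadingCoeff, h1] at h2
    set a := p.coeff k / (T ℝ k).coeff k with ha
    obtain ⟨c, hc⟩ := ih (p := p - a • T ℝ k) (by
      rw [degree_lt_iff_coeff_zero] at hp ⊢
      intro l hl
      rw [coeff_sub, coeff_smul, smul_eq_mul]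
      rcases hl.eq_or_lt with rfl | hl
      · rw [ha, div_mul_cancel₀ _ hlead, sub_self]
      · rw [hp l hl, coeff_eq_zero_of_degree_lt (p := T ℝ k), mul_zero, sub_zero]
        rw [degree_T]
        simpa using hl)
    refine ⟨fun i => if i = k then a else c i, ?_⟩
    rw [Finset.sum_range_succ]
    beta_reduce
    rw [if_pos rfl, Finset.sum_congr rfl (g := fun i => c i • T ℝ i), ← hc,
      sub_add_cancel]
    intro i hi
    rw [if_neg (Finset.mem_range.1 hi).ne]

/-- The Chebyshev coefficients of a polynomial bounded by `M` on `[-1, 1]` are at most `2 M`. -/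
theorem abs_coeff_le_of_eq_sum_T {k : ℕ} {c : ℕ → ℝ} {M : ℝ}
    (h : ∀ x, |x| ≤ 1 → |(∑ i ∈ Finset.range k, c i • T ℝ i).eval x| ≤ M) {j : ℕ} (hj : j < k) :
    |c j| ≤ 2 * M := by
  set p := ∑ i ∈ Finset.range k, c i • T ℝ i with hp
  have hint : ∀ g : ℝ[X], MeasureTheory.Integrable (fun x => g.eval x) measureT := fun g =>
    integrable_measureT (by fun_prop)
  have h1 : ∫ x, p.eval x * (T ℝ j).eval x ∂measureT =
      c j * ∫ x, (T ℝ j).eval x * (T ℝ j).eval x ∂measureT := by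
    have h2 : ∀ x, p.eval x * (T ℝ j).eval x =
        ∑ i ∈ Finset.range k, c i * ((T ℝ i).eval x * (T ℝ j).eval x) := fun x => by
      rw [hp, eval_finsetSum, Finset.sum_mul]
      exact Finset.sum_congr rfl fun i _ => by rw [eval_smul, smul_eq_mul, mul_assoc]
    simp only [h2]
    rw [MeasureTheory.integral_finsetSum]
    · rw [Finset.sum_eq_single_of_mem j (Finset.mem_range.2 hj),
        MeasureTheory.integral_const_mul]
      intro i _ hij
      rw [MeasureTheory.integral_const_mul, integral_eval_T_real_mul_eval_T_real_measureT_of_ne hij,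
        mul_zero]
    · intro i _
      have := (hint (T ℝ i * T ℝ j)).const_mul (c i)
      simpa using this
  have h3 : Real.pi / 2 ≤ ∫ x, (T ℝ j).eval x * (T ℝ j).eval x ∂measureT := by
    rcases eq_or_ne j 0 with rfl | hj0
    · have := integral_eval_T_real_mul_self_measureT_zero
      rw [Nat.cast_zero, this]
      linarith [Real.pi_pos]
    · rw [integral_T_real_mul_self_measureT_of_ne_zero hj0]
  have h4 : |∫ x, p.eval x * (T ℝ j).eval x ∂measureT| ≤ M * Real.pi := by
    rw [integral_measureT_eq_integral_cos]
    have := intervalIntegral.norm_integral_le_of_norm_le_const (a := 0) (b := Real.pi) (C := M)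
      (f := fun θ => p.eval (Real.cos θ) * (T ℝ j).eval (Real.cos θ)) (fun θ _ => by
        rw [Real.norm_eq_abs, abs_mul]
        have h5 := h _ (Real.abs_cos_le_one θ)
        have h6 := abs_eval_T_real_le_one (j : ℤ) (Real.abs_cos_le_one θ)
        calc _ ≤ M * 1 := by gcongr; exact (abs_nonneg _).trans h5
          _ = M := mul_one M)
    rwa [sub_zero, abs_of_pos Real.pi_pos, Real.norm_eq_abs] at this
  rw [h1, abs_mul] at h4
  have h5 : |c j| * (Real.pi / 2) ≤ M * Real.pi := by
    refine le_trans ?_ h4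
    gcongr
    exact h3.trans (le_abs_self _)
  have := Real.pi_pos
  nlinarith

theorem sum_range_sub_cast (j : ℕ) (x : ℝ) :
    ∑ l ∈ Finset.range j, (x - l) = j * x - j * (j - 1) / 2 := by
  induction j with
  | zero => simp
  | succ j ih => rw [Finset.sum_range_succ, ih]; push_cast; ring

variable {E G : Type*} [NormedAddCommGroup E] [NormedSpace ℝ E]
  [NormedAddCommGroup G] [NormedSpace ℝ G]

theorem aeval_two_mul_X_mul_sub_apply (B : E →L[ℝ] E) (p r : ℝ[X]) (x : E) :
    aeval B (2 * X * p - r) x = (2 : ℝ) • B (aeval B p x) - aeval B r x := by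
  rw [map_sub, mul_assoc, two_mul, map_add, map_mul, aeval_X, two_smul]
  rfl

/-- An inhomogeneous Chebyshev recurrence is solved by convolution with the Chebyshev polynomials of
the second kind. -/
theorem eq_sum_of_chebyshev_recurrence {B : E →L[ℝ] E} {d ξ : ℕ → E} (h0 : d 0 = 0)
    (h1 : d 1 = ξ 0)
    (h2 : ∀ j, d (j + 2) = (2 : ℝ) • B (d (j + 1)) - d j + (2 : ℝ) • ξ (j + 1)) (j : ℕ) :
    d j = ∑ l ∈ Finset.range j,
      (if l = 0 then (1 : ℝ) else 2) • aeval B (U ℝ ((j : ℤ) - 1 - l)) (ξ l) := by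
  induction j using Nat.twoStepInduction with
  | zero => simp [h0]
  | one => simp [h1]
  | more j ih1 ih2 =>
    rw [h2, ih1, ih2, Finset.sum_range_succ _ (j + 1), map_sum, Finset.smul_sum]
    have h3 : ∑ l ∈ Finset.range j,
        (if l = 0 then (1 : ℝ) else 2) • aeval B (U ℝ ((j : ℤ) - 1 - l)) (ξ l) =
        ∑ l ∈ Finset.range (j + 1),
        (if l = 0 then (1 : ℝ) else 2) • aeval B (U ℝ ((j : ℤ) - 1 - l)) (ξ l) := by
      rw [Finset.sum_range_succ, show (j : ℤ) - 1 - j = -1 by ring, U_neg_one]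
      simp
    rw [h3, ← Finset.sum_sub_distrib]
    congr 1
    · refine Finset.sum_congr rfl fun l _ => ?_
      have h4 : U ℝ (((j + 2 : ℕ) : ℤ) - 1 - l) =
          2 * X * U ℝ (((j + 1 : ℕ) : ℤ) - 1 - l) - U ℝ ((j : ℤ) - 1 - l) := by
        rw [U_eq]
        congr 2
        · congr 1; push_cast; ring
        · push_cast; ring
      rw [h4, aeval_two_mul_X_mul_sub_apply, smul_sub, map_smul, smul_comm (2 : ℝ)]
    · rw [if_neg (by omega), show ((j + 2 : ℕ) : ℤ) - 1 - ((j + 1 : ℕ) : ℤ) = 0 by push_cast; ring,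
        U_zero, map_one]
      rfl

/-- If `A Q - Q T` is small, then so is `P(A) Q e - Q P(T) e` for a Chebyshev polynomial `P`. -/
theorem norm_aeval_T_sub_le {A : E →L[ℝ] E} {S : G →L[ℝ] G} {Q : G →ₗ[ℝ] E} {e : G} {κ : ℝ}
    {k : ℕ} (hU : ∀ j : ℕ, ‖aeval A (U ℝ j)‖ ≤ j + 1)
    (hF : ∀ j, j + 1 < k → ‖A (Q (aeval S (T ℝ j) e)) - Q (S (aeval S (T ℝ j) e))‖ ≤ κ)
    {j : ℕ} (hj : j < k) :
    ‖aeval A (T ℝ j) (Q e) - Q (aeval S (T ℝ j) e)‖ ≤ j * (j + 1) * κ := by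
  set d : ℕ → E := fun j => aeval A (T ℝ j) (Q e) - Q (aeval S (T ℝ j) e) with hd
  set ξ : ℕ → E := fun j => A (Q (aeval S (T ℝ j) e)) - Q (S (aeval S (T ℝ j) e)) with hξ
  have h0 : d 0 = 0 := by simp [hd]
  have h1 : d 1 = ξ 0 := by simp [hd, hξ]
  have h2 : ∀ j, d (j + 2) = (2 : ℝ) • A (d (j + 1)) - d j + (2 : ℝ) • ξ (j + 1) := by
    intro j
    simp only [hd, hξ]
    push_cast
    rw [T_add_two, aeval_two_mul_X_mul_sub_apply, aeval_two_mul_X_mul_sub_apply, map_sub, map_sub,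
      map_smul]
    module
  have h3 := eq_sum_of_chebyshev_recurrence h0 h1 h2 j
  change ‖d j‖ ≤ _
  have hκ : ∑ l ∈ Finset.range j, 2 * (((j : ℝ) - l) * κ) = j * (j + 1) * κ := by
    rw [← Finset.mul_sum, ← Finset.sum_mul, sum_range_sub_cast]
    ring
  rw [h3, ← hκ]
  refine (norm_sum_le _ _).trans (Finset.sum_le_sum fun l hl => ?_)
  have hlj := Finset.mem_range.1 hl
  rw [norm_smul]
  have h4 : ‖aeval A (U ℝ ((j : ℤ) - 1 - l))‖ ≤ (j : ℝ) - l := by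
    have h5 := hU (j - 1 - l)
    rw [show ((j - 1 - l : ℕ) : ℤ) = (j : ℤ) - 1 - l by omega] at h5
    refine h5.trans (le_of_eq ?_)
    have : j = (j - 1 - l) + 1 + l := by omega
    conv_rhs => rw [this]
    push_cast
    ring
  have h6 : 0 ≤ (j : ℝ) - l := by rw [sub_nonneg]; exact_mod_cast hlj.le
  gcongr
  · split_ifs <;> norm_num
  · refine (ContinuousLinearMap.le_opNorm _ _).trans ?_
    gcongr
    exact hF l (by omega)

end Chebyshev

/-! ### Polynomials in `A` and in `T` -/

section Cfc

variable {ι : Type*} [Fintype ι] [DecidableEq ι] {A : Matrix ι ι ℝ}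

theorem norm_hermitian_cfc_le (hA : A.IsHermitian) {g : ℝ → ℝ} {M : ℝ} (hM : 0 ≤ M)
    (h : ∀ i, |g (hA.eigenvalues i)| ≤ M) : ‖hA.cfc g‖ ≤ M := by
  rw [IsHermitian.cfc, Unitary.conjStarAlgAut_apply, ← Unitary.coe_star,
    CStarRing.norm_mul_coe_unitary, CStarRing.norm_coe_unitary_mul, l2_opNorm_diagonal]
  exact (pi_norm_le_iff_of_nonneg hM).2 h

theorem hermitian_cfc_sub (hA : A.IsHermitian) (f g : ℝ → ℝ) :
    hA.cfc f - hA.cfc g = hA.cfc fun x => f x - g x := by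
  rw [IsHermitian.cfc, IsHermitian.cfc, IsHermitian.cfc, ← map_sub, diagonal_sub]
  rfl

theorem hermitian_cfc_eval (hA : A.IsHermitian) (p : ℝ[X]) :
    hA.cfc (fun x => p.eval x) = aeval A p :=
  (hA.cfc_eq _).symm.trans (cfc_polynomial p A hA)

theorem norm_hermitian_cfc_sub_aeval_le (hA : A.IsHermitian) {f : ℝ → ℝ} {p : ℝ[X]} {M : ℝ}
    (hM : 0 ≤ M) (h : ∀ i, |f (hA.eigenvalues i) - p.eval (hA.eigenvalues i)| ≤ M) :
    ‖hA.cfc f - aeval A p‖ ≤ M := by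
  rw [← hermitian_cfc_eval hA, hermitian_cfc_sub]
  exact norm_hermitian_cfc_le hA hM h

/-- `A` as an operator on Euclidean space, rescaled so that `[a, b]` becomes `[-1, 1]`. -/
noncomputable def rescaled (A : Matrix ι ι ℝ) (a b : ℝ) :
    EuclideanSpace ℝ ι →L[ℝ] EuclideanSpace ℝ ι :=
  ((b - a) / 2)⁻¹ • (toEuclideanCLM (𝕜 := ℝ) A - ((a + b) / 2) • 1)

theorem aeval_rescaled_comp {a b : ℝ} (hab : a < b) (A : Matrix ι ι ℝ) (p : ℝ[X]) :
    aeval (rescaled A a b) (p.comp (((b - a) / 2) • X + Polynomial.C ((a + b) / 2))) =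
      toEuclideanCLM (𝕜 := ℝ) (aeval A p) := by
  have h1 : aeval (rescaled A a b) (((b - a) / 2) • X + Polynomial.C ((a + b) / 2)) =
      toEuclideanCLM (𝕜 := ℝ) A := by
    have h2 : (b - a) / 2 ≠ 0 := by linarith
    rw [map_add, map_smul, aeval_X, Polynomial.aeval_C, rescaled, smul_inv_smul₀ h2,
      Algebra.algebraMap_eq_smul_one, sub_add_cancel]
  rw [aeval_comp, h1]
  exact aeval_algHom_apply (toEuclideanCLM (n := ι) (𝕜 := ℝ)).toAlgEquiv.toAlgHom A p

theorem norm_aeval_rescaled_le (hA : A.IsHermitian) {a b : ℝ} (hab : a < b)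
    (h : ∀ i, hA.eigenvalues i ∈ Set.Icc a b) {p : ℝ[X]} {M : ℝ}
    (hp : ∀ x, |x| ≤ 1 → |p.eval x| ≤ M) : ‖aeval (rescaled A a b) p‖ ≤ M := by
  have hM : 0 ≤ M := (abs_nonneg _).trans (hp 0 (by simp))
  set l : ℝ[X] := ((b - a) / 2)⁻¹ • (X - Polynomial.C ((a + b) / 2)) with hl
  have h0 : (b - a) / 2 ≠ 0 := by linarith
  have h1 : p = (p.comp l).comp (((b - a) / 2) • X + Polynomial.C ((a + b) / 2)) := by
    rw [comp_assoc, hl, smul_comp, sub_comp, X_comp, C_comp, add_sub_cancel_right,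
      inv_smul_smul₀ h0, comp_X]
  rw [h1, aeval_rescaled_comp hab, l2_opNorm_toEuclideanCLM, ← hermitian_cfc_eval hA]
  refine norm_hermitian_cfc_le hA hM fun i => ?_
  rw [eval_comp]
  refine hp _ ?_
  obtain ⟨h2, h3⟩ := h i
  rw [hl, eval_smul, eval_sub, eval_X, eval_C, smul_eq_mul, abs_le, inv_mul_eq_div,
    le_div_iff₀ (by linarith), div_le_iff₀ (by linarith)]
  constructor <;> linarith

end Cfc

section Krylov

variable {n m : ℕ} {q : ℕ → EuclideanSpace ℝ (Fin n)} {α β : ℕ → ℝ}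

theorem norm_sum_smul_le {E : Type*} [NormedAddCommGroup E] [NormedSpace ℝ E] {g : Fin m → E}
    {C : ℝ} (hC : 0 ≤ C) (hg : ∀ i, ‖g i‖ ≤ C) (v : EuclideanSpace ℝ (Fin m)) :
    ‖∑ i, v i • g i‖ ≤ C * √m * ‖v‖ := by
  have h1 : ∑ i, |v i| ≤ √m * ‖v‖ := by
    refine abs_le_of_sq_le_sq' ?_ (by positivity) |>.2
    rw [mul_pow, Real.sq_sqrt (by positivity), EuclideanSpace.norm_sq_eq]
    have := sq_sum_le_card_mul_sum_sq (s := Finset.univ) (f := fun i => |v i|)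
    simpa using this
  calc _ ≤ ∑ i, |v i| * C := by
        refine (norm_sum_le _ _).trans (Finset.sum_le_sum fun i _ => ?_)
        rw [norm_smul, Real.norm_eq_abs]
        gcongr
        exact hg i
    _ = C * ∑ i, |v i| := by rw [← Finset.sum_mul, mul_comm]
    _ ≤ C * (√m * ‖v‖) := by gcongr
    _ = _ := by ring

theorem toEuclideanLin_lanczosQ (v : EuclideanSpace ℝ (Fin m)) :
    toEuclideanLin (lanczosQ m q) v = ∑ i : Fin m, v i • q (i + 1) := by
  ext x
  rw [toLpLin_apply]
  simp [mulVec, dotProduct, lanczosQ, mul_comm]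

theorem toEuclideanLin_lanczosQ_lanczosT (hβ : β 1 = 0) {v : EuclideanSpace ℝ (Fin m)}
    (hv : ∀ l : Fin m, (l : ℕ) + 1 = m → β (m + 1) * v l = 0) :
    toEuclideanLin (lanczosQ m q) (toEuclideanCLM (𝕜 := ℝ) (lanczosT m α β) v) =
      ∑ l : Fin m, v l • (β (l + 2) • q (l + 2) + α (l + 1) • q (l + 1) + β (l + 1) • q l) := by
  rw [toEuclideanLin_lanczosQ]
  ext x
  have h1 : ∀ l : Fin m, ∑ i : Fin m, lanczosT m α β l i * q (i + 1) x = _ := fun l =>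
    lanczosT_sum_mul hβ (fun i => q i x) l
  have h2 : ∀ i : Fin m, (toEuclideanCLM (𝕜 := ℝ) (lanczosT m α β) v) i =
      ∑ l, lanczosT m α β l i * v l := fun i => by
    rw [ofLp_toEuclideanCLM]
    change ∑ l, lanczosT m α β i l * v l = _
    refine Finset.sum_congr rfl fun l _ => ?_
    rw [show lanczosT m α β i l = lanczosT m α β l i from (lanczosT_isHermitian m α β).apply l i]
  simp only [WithLp.ofLp_sum, Finset.sum_apply, PiLp.smul_apply, PiLp.add_apply, smul_eq_mul, h2,
    Finset.sum_mul]
  rw [Finset.sum_comm]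
  refine Finset.sum_congr rfl fun l _ => ?_
  have h3 : ∀ i : Fin m, lanczosT m α β l i * v l * q (i + 1) x =
      v l * (lanczosT m α β l i * q (i + 1) x) := fun i => by ring
  simp only [h3]
  rw [← Finset.mul_sum, h1]
  split_ifs with h
  · have h4 := hv l h
    have h5 : v l * (β (l + 2) * q (l + 2) x) = 0 := by
      rw [show (l : ℕ) + 2 = m + 1 by omega, ← mul_assoc, mul_comm (v l), h4, zero_mul]
    linear_combination -h5
  · ring

/-- `A Q - Q T` is small on vectors that do not see the vector `q_{m+1}` cut off by `T`. -/
theorem ApproxLanczos.norm_commutator_le {A : Matrix (Fin n) (Fin n) ℝ} {δ : ℝ}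
    (h : ApproxLanczos (toEuclideanLin A) m q α β δ) (hm : 1 ≤ m)
    {v : EuclideanSpace ℝ (Fin m)} (hv : ∀ l : Fin m, (l : ℕ) + 1 = m → β (m + 1) * v l = 0) :
    ‖toEuclideanCLM (𝕜 := ℝ) A (toEuclideanLin (lanczosQ m q) v) -
      toEuclideanLin (lanczosQ m q) (toEuclideanCLM (𝕜 := ℝ) (lanczosT m α β) v)‖ ≤
      8.2 * δ * √m * ‖v‖ := by
  have hδ := h.nonneg hm
  rw [toEuclideanLin_lanczosQ_lanczosT h.beta_one hv, toEuclideanLin_lanczosQ, map_sum,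
    ← Finset.sum_sub_distrib]
  simp only [map_smul, ← smul_sub]
  exact norm_sum_smul_le (by positivity) (fun i => h.residual (i + 1) (by omega) (by omega)) v

theorem rescaled_commutator {A : Matrix (Fin n) (Fin n) ℝ} {T : Matrix (Fin m) (Fin m) ℝ}
    (Q : EuclideanSpace ℝ (Fin m) →ₗ[ℝ] EuclideanSpace ℝ (Fin n)) (a b : ℝ)
    (v : EuclideanSpace ℝ (Fin m)) :
    rescaled A a b (Q v) - Q (rescaled T a b v) = ((b - a) / 2)⁻¹ •
      (toEuclideanCLM (𝕜 := ℝ) A (Q v) - Q (toEuclideanCLM (𝕜 := ℝ) T v)) := by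
  have h : ∀ {l : ℕ} (M : Matrix (Fin l) (Fin l) ℝ) (w : EuclideanSpace ℝ (Fin l)),
      rescaled M a b w =
        ((b - a) / 2)⁻¹ • (toEuclideanCLM (𝕜 := ℝ) M w - ((a + b) / 2) • w) := fun M w => rfl
  rw [h, h, map_smul, map_sub, map_smul]
  module

/-- A polynomial of degree `j` in a tridiagonal matrix maps `e₁` to a vector supported on the first
`j + 1` coordinates. -/
theorem aeval_rescaled_lanczosT_apply_eq_zero {a b : ℝ} (j : ℕ) {i : Fin m} (hi : j < i) :
    (aeval (rescaled (lanczosT m α β) a b) (T ℝ j) (WithLp.toLp 2 (e1 m))) i = 0 := by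
  have hstep : ∀ (l : ℕ) (w : EuclideanSpace ℝ (Fin m)), (∀ i : Fin m, l < i → w i = 0) →
      ∀ i : Fin m, l + 1 < i → rescaled (lanczosT m α β) a b w i = 0 := by
    intro l w hw i hi
    have h1 : rescaled (lanczosT m α β) a b w = ((b - a) / 2)⁻¹ •
      (toEuclideanCLM (𝕜 := ℝ) (lanczosT m α β) w - ((a + b) / 2) • w) := rfl
    have h2 : (toEuclideanCLM (𝕜 := ℝ) (lanczosT m α β) w) i = 0 := by
      rw [ofLp_toEuclideanCLM]
      change ∑ r, lanczosT m α β i r * w r = 0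
      refine Finset.sum_eq_zero fun r _ => ?_
      rcases le_or_gt (r : ℕ) l with h3 | h3
      · rw [lanczosT, of_apply, if_neg (by omega), if_neg (by omega), if_neg (by omega), zero_mul]
      · rw [hw r h3, mul_zero]
    rw [h1, PiLp.smul_apply, PiLp.sub_apply, PiLp.smul_apply, h2, hw i (by omega)]
    simp
  induction j using Nat.twoStepInduction generalizing i with
  | zero =>
    simp only [Nat.cast_zero, T_zero, map_one, one_apply_eq_self, e1]
    rw [if_neg (by omega)]
  | one =>
    simp only [Nat.cast_one, T_one, aeval_X]
    refine hstep 0 _ (fun r hr => ?_) i hi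
    simp only [e1]
    rw [if_neg (by omega)]
  | more j ih1 ih2 =>
    push_cast
    rw [T_add_two, aeval_two_mul_X_mul_sub_apply, PiLp.sub_apply, PiLp.smul_apply,
      ih1 (by omega)]
    have h3 := hstep (j + 1) _ (fun r hr => ih2 hr) i hi
    push_cast at h3
    rw [h3]
    simp

theorem norm_toLp_e1 (hm : 1 ≤ m) : ‖WithLp.toLp 2 (e1 m)‖ = 1 := by
  have : e1 m = Pi.single (⟨0, hm⟩ : Fin m) 1 := by
    ext j
    simp [e1, Pi.single_apply, Fin.ext_iff]
  rw [this]
  simp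

theorem toEuclideanLin_lanczosQ_e1 (hm : 1 ≤ m) :
    toEuclideanLin (lanczosQ m q) (WithLp.toLp 2 (e1 m)) = q 1 := by
  rw [toEuclideanLin_lanczosQ, Finset.sum_eq_single_of_mem (⟨0, hm⟩ : Fin m) (Finset.mem_univ _)]
  · simp [e1]
  · intro j _ hj
    have : (j : ℕ) ≠ 0 := fun h0 => hj (Fin.ext h0)
    simp [e1, this]

/-- Polynomials of degree less than `k` in `A` and `T` act almost alike. -/
theorem ApproxLanczos.norm_aeval_sub_le {A : Matrix (Fin n) (Fin n) ℝ} (hA : A.IsHermitian)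
    {δ a b M : ℝ} (h : ApproxLanczos (toEuclideanLin A) m q α β δ) {k : ℕ} (hm : 1 ≤ m)
    (hfin : m = k ∨ β (m + 1) = 0) (hab : a < b)
    (hAe : ∀ i, hA.eigenvalues i ∈ Set.Icc a b)
    (hTe : ∀ i, (lanczosT_isHermitian m α β).eigenvalues i ∈ Set.Icc a b)
    {p : ℝ[X]} (hp : p.degree < k) (hM : ∀ x ∈ Set.Icc a b, |p.eval x| ≤ M) :
    ‖toEuclideanCLM (𝕜 := ℝ) (aeval A p) (q 1) - toEuclideanLin (lanczosQ m q)
      (toEuclideanCLM (𝕜 := ℝ) (aeval (lanczosT m α β) p) (WithLp.toLp 2 (e1 m)))‖ ≤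
      2 * M * k ^ 3 * (8.2 * δ * √m / ((b - a) / 2)) := by
  have hδ := h.nonneg hm
  have hr : 0 < (b - a) / 2 := by linarith
  set κ := 8.2 * δ * √m / ((b - a) / 2) with hκ
  have hκ0 : 0 ≤ κ := by positivity
  set Q := toEuclideanLin (lanczosQ m q) with hQ
  set e := WithLp.toLp 2 (e1 m) with he
  set l : ℝ[X] := ((b - a) / 2) • X + Polynomial.C ((a + b) / 2) with hl
  have hT : ∀ j : ℕ, ‖aeval (rescaled (lanczosT m α β) a b) (T ℝ j) e‖ ≤ 1 := fun j => by
    refine (ContinuousLinearMap.le_opNorm _ _).trans ?_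
    rw [he, norm_toLp_e1 hm, mul_one]
    exact norm_aeval_rescaled_le (lanczosT_isHermitian m α β) hab hTe
      fun x hx => abs_eval_T_real_le_one _ hx
  have key : ∀ j, j < k → ‖aeval (rescaled A a b) (T ℝ j) (Q e) -
      Q (aeval (rescaled (lanczosT m α β) a b) (T ℝ j) e)‖ ≤ j * (j + 1) * κ := by
    intro j hj
    refine norm_aeval_T_sub_le (fun j => norm_aeval_rescaled_le hA hab hAe
      fun x hx => abs_eval_U_real_le j hx) (fun i hi => ?_) hj
    rw [rescaled_commutator, norm_smul, norm_inv, Real.norm_of_nonneg hr.le, hκ, inv_mul_eq_div]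
    gcongr
    refine (h.norm_commutator_le hm fun r hr' => ?_).trans
      (mul_le_of_le_one_right (by positivity) (hT i))
    rcases hfin with rfl | h0
    · rw [aeval_rescaled_lanczosT_apply_eq_zero i (by omega), mul_zero]
    · rw [h0, zero_mul]
  have hpl : (p.comp l).degree < k := by
    rcases eq_or_ne p 0 with rfl | hp0
    · simp
    · refine lt_of_le_of_lt ?_ ((natDegree_lt_iff_degree_lt hp0).2 hp |> WithBot.coe_lt_coe.2)
      refine degree_le_of_natDegree_le (natDegree_comp_le.trans ?_)
      have : l.natDegree ≤ 1 := by
        rw [hl, natDegree_add_C]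
        exact (natDegree_smul_le _ _).trans natDegree_X_le
      exact (Nat.mul_le_mul_left _ this).trans (mul_one _).le
  obtain ⟨c, hc⟩ := exists_eq_sum_T hpl
  have hM0 : 0 ≤ M := (abs_nonneg _).trans (hM a ⟨le_rfl, hab.le⟩)
  have hcM : ∀ j < k, |c j| ≤ 2 * M := fun j hj => by
    refine abs_coeff_le_of_eq_sum_T (fun x hx => ?_) hj
    rw [← hc, eval_comp]
    refine hM _ ?_
    rw [hl, eval_add, eval_smul, eval_X, eval_C, smul_eq_mul]
    rw [abs_le] at hx
    constructor <;> nlinarith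
  rw [← toEuclideanLin_lanczosQ_e1 (q := q) hm, ← hQ, ← he, ← aeval_rescaled_comp hab,
    ← aeval_rescaled_comp hab, ← hl, hc]
  simp only [map_sum, map_smul, _root_.sum_apply, _root_.smul_apply]
  rw [← Finset.sum_sub_distrib]
  simp only [← smul_sub]
  calc _ ≤ ∑ _j ∈ Finset.range k, 2 * M * ((k : ℝ) ^ 2 * κ) := by
        refine (norm_sum_le _ _).trans (Finset.sum_le_sum fun j hj => ?_)
        have hjk := Finset.mem_range.1 hj
        rw [norm_smul, Real.norm_eq_abs]
        refine mul_le_mul (hcM j hjk) ((key j hjk).trans ?_) (norm_nonneg _) (by positivity)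
        gcongr
        have : (j : ℝ) + 1 ≤ k := by exact_mod_cast hjk
        nlinarith [Nat.cast_nonneg (α := ℝ) j]
    _ = _ := by rw [Finset.sum_const, Finset.card_range, nsmul_eq_mul]; ring

end Krylov

/-! ### Best approximation and the error bound -/

section BestError

variable {f : ℝ → ℝ} {a b : ℝ}

theorem supAbs_nonneg (f : ℝ → ℝ) (a b : ℝ) : 0 ≤ supAbs f a b :=
  Real.iSup_nonneg fun _ => abs_nonneg _

theorem abs_le_supAbs (hf : BddAbove ((fun t => |f t|) '' Set.Icc a b)) {x : ℝ}
    (hx : x ∈ Set.Icc a b) : |f x| ≤ supAbs f a b := by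
  refine le_ciSup (f := fun x : Set.Icc a b => |f x|) ?_ ⟨x, hx⟩
  rwa [Set.image_eq_range] at hf

theorem bddAbove_abs_sub_eval (hf : BddAbove ((fun t => |f t|) '' Set.Icc a b)) (p : ℝ[X]) :
    BddAbove ((fun t => |f t - p.eval t|) '' Set.Icc a b) := by
  obtain ⟨B, hB⟩ := hf
  obtain ⟨D, hD⟩ := (isCompact_Icc (a := a) (b := b)).bddAbove_image
    (f := fun t => |p.eval t|) (by fun_prop)
  refine ⟨B + D, ?_⟩
  rintro _ ⟨t, ht, rfl⟩
  exact (abs_sub _ _).trans (add_le_add (hB ⟨t, ht, rfl⟩) (hD ⟨t, ht, rfl⟩))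

theorem bestError_le_supAbs (f : ℝ → ℝ) (a b : ℝ) (k : ℕ) : bestError f a b k ≤ supAbs f a b := by
  have h : BddBelow (Set.range fun p : degreeLT ℝ k =>
      supAbs (fun x => f x - (p : ℝ[X]).eval x) a b) :=
    ⟨0, by rintro _ ⟨p, rfl⟩; exact supAbs_nonneg _ _ _⟩
  refine (ciInf_le h 0).trans (le_of_eq ?_)
  simp

end BestError

/-- The error is split through a polynomial `p`: replacing `f` by `p` costs `‖q₁‖ Δ` on the side of
`A` and `‖Q‖ Δ` on the side of `T`. -/
theorem norm_lanczos_sub_le_of_polynomial {n m k : ℕ} {A : Matrix (Fin n) (Fin n) ℝ}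
    (hA : A.IsHermitian) {q : ℕ → EuclideanSpace ℝ (Fin n)} {α β : ℕ → ℝ} {δ a b Δ M : ℝ}
    (h : ApproxLanczos (toEuclideanLin A) m q α β δ) (hm : 1 ≤ m) (hmk : m ≤ k)
    (hfin : m = k ∨ β (m + 1) = 0) (hab : a < b)
    (hAe : ∀ i, hA.eigenvalues i ∈ Set.Icc a b)
    (hTe : ∀ i, (lanczosT_isHermitian m α β).eigenvalues i ∈ Set.Icc a b)
    {f : ℝ → ℝ} {p : ℝ[X]} (hp : p.degree < k) (hΔ : ∀ x ∈ Set.Icc a b, |f x - p.eval x| ≤ Δ)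
    (hM : ∀ x ∈ Set.Icc a b, |p.eval x| ≤ M) :
    ‖WithLp.toLp 2 ((hA.cfc f).mulVec (q 1).ofLp) -
        WithLp.toLp 2 ((lanczosQ m q).mulVec
          (((lanczosT_isHermitian m α β).cfc f).mulVec (e1 m)))‖ ≤
      (k + 2) * Δ + 2 * M * k ^ 3 * (8.2 * δ * √m / ((b - a) / 2)) := by
  have hΔ0 : 0 ≤ Δ := (abs_nonneg _).trans (hΔ a ⟨le_rfl, hab.le⟩)
  set hT := lanczosT_isHermitian m α β
  set Q := toEuclideanLin (lanczosQ m q) with hQ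
  have h1 : ‖toEuclideanCLM (𝕜 := ℝ) (hA.cfc f - aeval A p) (q 1)‖ ≤ Δ * 1.031 := by
    refine (ContinuousLinearMap.le_opNorm _ _).trans ?_
    rw [l2_opNorm_toEuclideanCLM]
    exact mul_le_mul (norm_hermitian_cfc_sub_aeval_le hA hΔ0 fun i => hΔ _ (hAe i))
      (h.norm_le 1 le_rfl hm) (norm_nonneg _) hΔ0
  have h2 : ‖Q (toEuclideanCLM (𝕜 := ℝ) (hT.cfc f - aeval (lanczosT m α β) p)
      (WithLp.toLp 2 (e1 m)))‖ ≤ 1.031 * √m * Δ := by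
    rw [hQ, toEuclideanLin_lanczosQ]
    refine (norm_sum_smul_le (by norm_num) (fun i => h.norm_le (i + 1) (by omega) (by omega))
      _).trans ?_
    gcongr
    refine (ContinuousLinearMap.le_opNorm _ _).trans ?_
    rw [l2_opNorm_toEuclideanCLM, norm_toLp_e1 hm, mul_one]
    exact norm_hermitian_cfc_sub_aeval_le hT hΔ0 fun i => hΔ _ (hTe i)
  have h3 := h.norm_aeval_sub_le hA hm hfin hab hAe hTe hp hM
  have h4 : WithLp.toLp 2 ((hA.cfc f).mulVec (q 1).ofLp) -
        WithLp.toLp 2 ((lanczosQ m q).mulVec ((hT.cfc f).mulVec (e1 m))) =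
      toEuclideanCLM (𝕜 := ℝ) (hA.cfc f - aeval A p) (q 1) +
      (toEuclideanCLM (𝕜 := ℝ) (aeval A p) (q 1) - Q
      (toEuclideanCLM (𝕜 := ℝ) (aeval (lanczosT m α β) p) (WithLp.toLp 2 (e1 m)))) -
      Q (toEuclideanCLM (𝕜 := ℝ) (hT.cfc f - aeval (lanczosT m α β) p)
        (WithLp.toLp 2 (e1 m))) := by
    have h5 : WithLp.toLp 2 ((hA.cfc f).mulVec (q 1).ofLp) =
      toEuclideanCLM (𝕜 := ℝ) (hA.cfc f) (q 1) := rfl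
    have h6 : WithLp.toLp 2 ((lanczosQ m q).mulVec ((hT.cfc f).mulVec (e1 m))) =
      Q (toEuclideanCLM (𝕜 := ℝ) (hT.cfc f) (WithLp.toLp 2 (e1 m))) := rfl
    rw [h5, h6, map_sub, map_sub, _root_.sub_apply, _root_.sub_apply, map_sub]
    abel
  rw [h4]
  refine (norm_sub_le _ _).trans ?_
  have h7 := norm_add_le (toEuclideanCLM (𝕜 := ℝ) (hA.cfc f - aeval A p) (q 1))
      (toEuclideanCLM (𝕜 := ℝ) (aeval A p) (q 1) - Q
      (toEuclideanCLM (𝕜 := ℝ) (aeval (lanczosT m α β) p) (WithLp.toLp 2 (e1 m))))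
  have h8 : √(m : ℝ) ≤ (k + 1) / 2 := by
    refine (Real.sqrt_le_sqrt (Nat.cast_le.2 hmk)).trans ?_
    have := Real.sq_sqrt (Nat.cast_nonneg (α := ℝ) k)
    nlinarith [sq_nonneg (√(k : ℝ) - 1)]
  have h9 : 1.031 * √m * Δ ≤ 1.031 * ((k + 1) / 2) * Δ := by gcongr
  have h10 : 0 ≤ (k : ℝ) * Δ := by positivity
  linarith

theorem natCast_le_rpow_three_halves {n : ℕ} (hn : 1 ≤ n) :
    (n : ℝ) ≤ (n : ℝ) ^ (3 / 2 : ℝ) := by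
  have h : (1 : ℝ) ≤ n := by exact_mod_cast hn
  calc (n : ℝ) = (n : ℝ) ^ (1 : ℝ) := (Real.rpow_one _).symm
    _ ≤ _ := Real.rpow_le_rpow_of_exponent_le h (by norm_num)

end FPLanczos

open FPLanczos
theorem mainTheorem5 {n : ℕ} (k m : ℕ) (ε η : ℝ)
    (A : Matrix (Fin n) (Fin n) ℝ) (hA : A.IsHermitian)
    (x : EuclideanSpace ℝ (Fin n)) (hx : x ≠ 0)
    (q : ℕ → EuclideanSpace ℝ (Fin n)) (α β : ℕ → ℝ)
    (hrun : LanczosRun ε A x k m q α β)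
    (hη : 0 < η)
    (hη_lower : 85 * (n : ℝ) ^ (3 / 2 : ℝ) * (k : ℝ) ^ (5 / 2 : ℝ) * ‖A‖ * ε ≤ η)
    (hη_upper : η ≤ ‖A‖)
    (f : ℝ → ℝ)
    (hf : BddAbove ((fun t => |f t|) '' Set.Icc (lamMin hA - η) (lamMax hA + η))) :
    ‖WithLp.toLp 2 ((hA.cfc f).mulVec (q 1).ofLp) -
        WithLp.toLp 2 ((lanczosQ m q).mulVec
          (((lanczosT_isHermitian m α β).cfc f).mulVec (e1 m)))‖ ≤
      ((k : ℝ) + 2) * bestError f (lamMin hA - η) (lamMax hA + η) k +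
        ε * (41 * supAbs f (lamMin hA - η) (lamMax hA + η) * (k : ℝ) ^ 4 *
          (n : ℝ) ^ (3 / 2 : ℝ) * ‖A‖ / η) := by
  have hn : 1 ≤ n := by
    by_contra! h0
    obtain rfl : n = 0 := by omega
    exact hx (Subsingleton.elim _ _)
  have hk : 1 ≤ k := hrun.one_le.trans hrun.le_k
  have hkR : (1 : ℝ) ≤ k := by exact_mod_cast hk
  have hε : 0 ≤ ε := by
    obtain ⟨_, _, hq⟩ := hrun.q_one
    exact (hq ⟨0, hn⟩).nonneg
  have hA0 : 0 < ‖A‖ := hη.trans_le hη_upper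
  set N := (n : ℝ) ^ (3 / 2 : ℝ) with hN
  have hnN : (n : ℝ) ≤ N := natCast_le_rpow_three_halves hn
  have hN1 : 1 ≤ N := le_trans (by exact_mod_cast hn) hnN
  set e := N * ε with he
  have hεe : ε ≤ e := le_mul_of_one_le_left hε hN1
  have he0 : 0 ≤ e := hε.trans hεe
  have hek : e * (k : ℝ) ^ (5 / 2 : ℝ) ≤ 1 / 85 := by
    refine le_of_mul_le_mul_right ?_ hA0
    rw [he]
    linarith
  have hk2 : e * (k : ℝ) ^ 2 ≤ 1 / 85 := by
    refine le_trans ?_ hek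
    gcongr
    rw [← Real.rpow_natCast]
    exact Real.rpow_le_rpow_of_exponent_le hkR (by norm_num)
  have he85 : e ≤ 1 / 85 := by
    refine le_trans ?_ hk2
    exact le_mul_of_one_le_right he0 (one_le_pow₀ hkR)
  have hne : n * ε ≤ e := by rw [he]; gcongr
  have hsmall : SmallPrecision n ε e := ⟨hε, hεe, he85,
    (one_add_pow_sub_one_le hε (hne.trans he85)).trans (by gcongr)⟩
  have happ := hrun.approxLanczos hsmall he hA hx hk2
  have hTe := happ.eigenvalues_mem hA hrun.one_le hrun.le_k (η := η) (by rw [he]; linarith)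
  set a := lamMin hA - η with ha
  set b := lamMax hA + η with hb
  have hmin : ∀ i, lamMin hA ≤ hA.eigenvalues i := fun i =>
    ciInf_le (Set.finite_range _).bddBelow i
  have hmax : ∀ i, hA.eigenvalues i ≤ lamMax hA := fun i =>
    le_ciSup (Set.finite_range _).bddAbove i
  have hAe : ∀ i, hA.eigenvalues i ∈ Set.Icc a b := fun i =>
    ⟨by linarith [hmin i], by linarith [hmax i]⟩
  have hηr : η ≤ (b - a) / 2 := by linarith [hmin ⟨0, hn⟩, hmax ⟨0, hn⟩]
  have hab : a < b := by linarith
  set C := supAbs f a b with hC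
  have hC0 : 0 ≤ C := supAbs_nonneg f a b
  set K := 16.4 * (k : ℝ) ^ 4 * (e * ‖A‖ / η) with hK
  have hK0 : 0 ≤ K := by positivity
  set LHS := ‖WithLp.toLp 2 ((hA.cfc f).mulVec (q 1).ofLp) -
        WithLp.toLp 2 ((lanczosQ m q).mulVec
          (((lanczosT_isHermitian m α β).cfc f).mulVec (e1 m)))‖
  -- Polynomials are bounded by `C + Δ` rather than `2 C`. Solving for `Δ` allows passing to the
  -- infimum, which need not be attained.
  have hpoly : ∀ p : Polynomial.degreeLT ℝ k,
      (LHS - K * C) / (k + 2 + K) ≤ supAbs (fun x => f x - (p : Polynomial ℝ).eval x) a b := by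
    rintro ⟨p, hp⟩
    rw [Polynomial.mem_degreeLT] at hp
    set Δ := supAbs (fun x => f x - p.eval x) a b with hΔdef
    have hΔ0 : 0 ≤ Δ := supAbs_nonneg _ a b
    have hΔ : ∀ x ∈ Set.Icc a b, |f x - p.eval x| ≤ Δ := fun x hx =>
      abs_le_supAbs (bddAbove_abs_sub_eval hf p) hx
    have hM : ∀ x ∈ Set.Icc a b, |p.eval x| ≤ C + Δ := fun x hx => by
      have h1 := abs_le_supAbs hf hx
      have h2 := abs_sub (f x) (f x - p.eval x)
      rw [sub_sub_cancel] at h2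
      linarith [hΔ x hx]
    have h1 := norm_lanczos_sub_le_of_polynomial hA happ hrun.one_le hrun.le_k hrun.stopped hab hAe
      hTe hp hΔ hM
    have hmk : √(m : ℝ) ≤ k := by
      refine (Real.sqrt_le_sqrt (Nat.cast_le.2 hrun.le_k)).trans ?_
      exact Real.sqrt_le_iff.2 ⟨by positivity, by nlinarith⟩
    have h2 : 2 * (C + Δ) * k ^ 3 * (8.2 * (e * ‖A‖) * √m / ((b - a) / 2)) ≤ K * (C + Δ) := by
      calc _ ≤ 2 * (C + Δ) * k ^ 3 * (8.2 * (e * ‖A‖) * k / η) := by gcongr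
        _ = _ := by rw [hK]; ring
    rw [div_le_iff₀ (by positivity)]
    linarith
  have hinf : (LHS - K * C) / (k + 2 + K) ≤ bestError f a b k := le_ciInf hpoly
  rw [div_le_iff₀ (by positivity)] at hinf
  -- The best error is at most `C`, so `K * (C + bestError f a b k) ≤ 2 * (K * C)`.
  have h3 : K * bestError f a b k ≤ K * C :=
    mul_le_mul_of_nonneg_left (bestError_le_supAbs f a b k) hK0
  have h4 : ε * (41 * C * (k : ℝ) ^ 4 * N * ‖A‖ / η) = 2.5 * (K * C) := by
    rw [hK, he]; ring
  have h5 : 0 ≤ K * C := by positivity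
  rw [h4]
  linarith
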